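/- Let $V=\mathbb R^{2g}$ with its standard symplectic form $\omega=\sum_i dx_i\wedge dy_i$, and let $$\mathfrak S_g=\{J\in\operatorname{End}V:\ J^2=-\mathrm{id},\ J^*\omega=\omega,\ \omega(x,Jx)>0\ \text{for } x\neq 0\}$$ be the Siegel upper half-space, with tangent spaces $T_J\mathfrak S_g=\{X\in\operatorname{End}V: XJ+JX=0,\ \omega(Xx,y)+\omega(x,Xy)=0\ \forall x,y\in V\}$, complex structure $X\mapsto JX$ on $T_J\mathfrak S_g$, and the Siegel metric $\langle X,Y\rangle=\operatorname{tr}(XY)$ (up to a constant factor, the $\mathrm{Sp}(2g,\mathbb R)$-invariant Riemannian metric). The tautological variation of Hodge structure of weight $1$ on $\mathfrak S_g$ has as flat bundle $\mathcal H$ the trivial bundle with fibre $V_{\mathbb C}^*$ and the trivial connection $\nabla$; its Hodge bundle is $\mathcal H^{1,0}_J=\operatorname{Ann}(V_J^{0,1})$, where $V_J^{0,1}\subset V_{\mathbb C}$ is the $(-i)$-eigenspace of $J$; its polarization $\mathcal Q$ is the complex bilinear form on $V_{\mathbb C}^*$ induced by $\omega$ through $V\cong V^*$; put $h(v,w)=i\mathcal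 Q(v,\bar w)$. Let $B\subset\mathfrak S_g$ be a connected (embedded) complex submanifold with $\dim_{\mathbb C}B=1$, and restrict this variation to $B$. Let $$\sigma:\mathcal H^{1,0}\to(\mathcal H/\mathcal H^{1,0})\otimes\Omega^1_B,\qquad \sigma_x(v)(s(x))=[(\nabla_v s)(x)]\quad(v\in T_xB,\ s\ \text{a local section of }\mathcal H^{1,0}),$$ be the second fundamental form of $\mathcal H^{1,0}\subset\mathcal H$. Let $\mathcal K=\ker\sigma\subset\mathcal H^{1,0}$ be the kernel bundle. Let $\mathbb U$ be the sheaf of sections of $\mathcal H^{1,0}$ that are flat for $\nabla^{hdg}=p\circ\nabla$, where $p:\mathcal H\to\mathcal H^{1,0}$ is the $h$-orthogonal projection, and let $\mathcal U=\mathbb U\otimes\mathcal O_B\subset\mathcal H^{1,0}$ be the unitary flat bundle, spanned over $\mathcal O_B$ by $\mathbb U$. Suppose that $B$ contains a geodesic segment, that is, a set $\gamma([a,b])$ with $\gamma:\mathbb R\to\mathfrak S_g$ a non-constant geodesic of the Siegel metric and $-\infty<a<b<+\infty$. Then $\mathcal K=\mathcal U$: the two subsheaves of $\mathcal H^{1,0}$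 coincide, and, at every $x\in B$, the subspace $\mathcal K_x=\ker\sigma_x$ of $\mathcal H^{1,0}_x$ coincides with the subspace $\mathcal U_x$ of values at $x$ of sections of $\mathbb U$ defined near $x$. -/

import Mathlib

open scoped ContDiff

noncomputable section

namespace SiegelVHS

/-! ### Siegel space -/

/-- The real vector space `V = ℝ^{2g}`, with coordinates `x_i` (left) and `y_i` (right). -/
abbrev V (g : ℕ) : Type := Fin g ⊕ Fin g → ℝ

/-- `End V`; every linear endomorphism of `V` is continuous. -/
abbrev EndV (g : ℕ) : Type := V g →L[ℝ] V g

/-- The dual `V_ℂ^*` of the complexification `V ⊗ ℂ`: a complex linear form on `V ⊗ ℂ` is the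
same thing as a real linear map `V → ℂ`. -/
abbrev DualC (g : ℕ) : Type := V g →L[ℝ] ℂ

variable {g : ℕ}

/-- The standard symplectic form `ω = ∑ i, dx_i ∧ dy_i` on `V`. -/
def omega (x y : V g) : ℝ :=
  ∑ i : Fin g, (x (Sum.inl i) * y (Sum.inr i) - x (Sum.inr i) * y (Sum.inl i))

/-- The Siegel upper half-space: complex structures `J` on `V` that preserve `ω` and for which
`g_J(x, y) = ω(x, J y)` is positive definite. -/
def siegelSpace (g : ℕ) : Set (EndV g) :=
  {J | (∀ x, J (J x) = -x) ∧ (∀ x y, omega (J x) (J y) = omega x y) ∧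
    ∀ x, x ≠ 0 → 0 < omega x (J x)}

/-- The tangent space `T_J 𝔖_g`, as a subspace of `End V`. -/
def tangentSpace (J : EndV g) : Set (EndV g) :=
  {X | (∀ x, X (J x) + J (X x) = 0) ∧ ∀ x y, omega (X x) y + omega x (X y) = 0}

/-- The trace form `⟨X, Y⟩ = tr (X Y)` on `End V`. It is a nondegenerate symmetric form on the
vector space `End V`, invariant under conjugation, and its restriction to each `T_J 𝔖_g` is
positive definite: this restriction is the Siegel metric (the `Sp(2g, ℝ)`-invariant Riemannian
metric, unique up to a constant factor). -/
def traceForm (X Y : EndV g) : ℝ :=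
  LinearMap.trace ℝ (V g) ((X.comp Y : EndV g) : V g →ₗ[ℝ] V g)

/-- Geodesics `ℝ → 𝔖_g` of the Siegel metric: smooth curves with `∇_{γ'} γ' = 0`, where `∇` is
the Levi-Civita connection. As the metric on `𝔖_g ⊆ End V` is induced by the constant
nondegenerate form `traceForm`, `∇_{γ'} γ'` is the component of the acceleration `γ''` in
`T_γ 𝔖_g`, orthogonal projection being taken with respect to that form. -/
structure IsGeodesic (γ : ℝ → EndV g) : Prop where
  contDiff : ContDiff ℝ ∞ γ
  mem : ∀ t, γ t ∈ siegelSpace g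
  covDeriv_eq_zero : ∀ t, ∀ Y ∈ tangentSpace (γ t), traceForm (deriv (deriv γ) t) Y = 0

/-- A geodesic segment: `γ([a, b])` for a non-constant geodesic `γ : ℝ → 𝔖_g` and `a < b`. -/
def IsGeodesicSegment (S : Set (EndV g)) : Prop :=
  ∃ (γ : ℝ → EndV g) (a b : ℝ), IsGeodesic γ ∧ (∃ t t', γ t ≠ γ t') ∧ a < b ∧
    S = γ '' Set.Icc a b

/-! ### Complex curves in Siegel space -/

/-- `φ`, on the open set `D ⊆ ℂ`, is a holomorphic parametrization of an open piece of
`B ⊆ 𝔖_g`: a holomorphic immersion for the complex structure `X ↦ J X` of `T_J 𝔖_g`, and a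
homeomorphism of `D` onto an open subset of `B`. -/
structure IsLocalParam (B : Set (EndV g)) (D : Set ℂ) (φ : ℂ → EndV g) : Prop where
  isOpen : IsOpen D
  smooth : ContDiffOn ℝ ∞ φ D
  holomorphic : ∀ z ∈ D, ∀ w : ℂ,
    fderiv ℝ φ z (Complex.I * w) = (φ z).comp (fderiv ℝ φ z w)
  immersion : ∀ z ∈ D, Function.Injective (fderiv ℝ φ z)
  embedding : Topology.IsEmbedding (D.domRestrict φ)
  open_image : ∃ W : Set (EndV g), IsOpen W ∧ φ '' D = B ∩ W

/-- `B` is an (embedded) complex submanifold of `𝔖_g` of complex dimension one. -/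
structure IsComplexCurve (B : Set (EndV g)) : Prop where
  subset : B ⊆ siegelSpace g
  exists_param : ∀ x ∈ B, ∃ D φ, IsLocalParam B D φ ∧ x ∈ φ '' D

/-- `A` is an open subset of `B`. -/
def IsOpenIn (B A : Set (EndV g)) : Prop := ∃ W : Set (EndV g), IsOpen W ∧ A = B ∩ W

/-- `s` is a holomorphic function on the open subset `A` of the curve `B`, with values in a
complex normed space. Only the values of `s` on `A` matter. -/
def IsHolomorphicOn {E : Type*} [NormedAddCommGroup E] [NormedSpace ℂ E]
    (B A : Set (EndV g)) (s : EndV g → E) : Prop :=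
  ∀ D φ, IsLocalParam B D φ → Set.MapsTo φ D A → DifferentiableOn ℂ (s ∘ φ) D

/-- `s` is a smooth function on the open subset `A` of the curve `B`. -/
def IsSmoothOn {E : Type*} [NormedAddCommGroup E] [NormedSpace ℝ E]
    (B A : Set (EndV g)) (s : EndV g → E) : Prop :=
  ∀ D φ, IsLocalParam B D φ → Set.MapsTo φ D A → ContDiffOn ℝ ∞ (s ∘ φ) D

/-! ### The tautological variation of Hodge structure

The flat bundle `ℋ` is the trivial bundle with fibre `V_ℂ^*`, so that its sections are functions
with values in `DualC g`, and the flat connection is the usual derivative. -/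

/-- The Hodge bundle: `ℋ^{1,0}_J` is the annihilator in `V_ℂ^*` of
`V_J^{0,1} = {x + i J x : x ∈ V}`, the `(-i)`-eigenspace of `J` in `V ⊗ ℂ`. -/
def hodge10 (J : EndV g) : Submodule ℂ (DualC g) where
  carrier := {α | ∀ x, α x + Complex.I * α (J x) = 0}
  zero_mem' := by simp
  add_mem' := by
    intro α β hα hβ x
    have h1 := hα x
    have h2 := hβ x
    simp only [add_apply]
    linear_combination h1 + h2
  smul_mem' := by
    intro c α hα x
    have h1 := hα x
    simp only [smul_apply, smul_eq_mul]
    linear_combination c * h1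

/-- The polarization `𝒬` on `V_ℂ^*`: the complex bilinear extension of the symplectic form on
`V^*` that corresponds to `ω` under `V ≅ V^*`, `v ↦ ω(v, ·)`. -/
def polarization (α β : DualC g) : ℂ :=
  ∑ i : Fin g, (α (Pi.single (Sum.inl i) 1) * β (Pi.single (Sum.inr i) 1)
    - α (Pi.single (Sum.inr i) 1) * β (Pi.single (Sum.inl i) 1))

/-- The complex conjugate of an element of `V_ℂ^*`. -/
def conjDual (β : DualC g) : DualC g := (Complex.conjCLE : ℂ →L[ℝ] ℂ).comp β

/-- The Hodge form `h(α, β) = i 𝒬(α, β̄)`, which is positive definite on `ℋ^{1,0}_J`. -/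
def hodgeForm (α β : DualC g) : ℂ := Complex.I * polarization α (conjDual β)

/-- `∇_v s (x) = ξ` for the flat connection `∇` of `ℋ` restricted to `B`, where `v ∈ T_x B`: in a
local parametrization `φ` of `B` with `φ z = x` and `dφ_z(w) = v`, `ξ` is the derivative of
`s ∘ φ` at `z` in the direction `w`. -/
def IsNabla (B : Set (EndV g)) (s : EndV g → DualC g) (x v : EndV g) (ξ : DualC g) : Prop :=
  ∃ D φ z w, IsLocalParam B D φ ∧ z ∈ D ∧ φ z = x ∧ fderiv ℝ φ z w = v ∧
    fderiv ℝ (s ∘ φ) z w = ξ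

/-- Holomorphic sections of `ℋ^{1,0}` over the open subset `A` of `B`. -/
structure IsHodgeSection (B A : Set (EndV g)) (s : EndV g → DualC g) : Prop where
  holomorphic : IsHolomorphicOn B A s
  mem : ∀ x ∈ A, s x ∈ hodge10 x

/-- `σ_x(s(x)) = 0`, where `σ : ℋ^{1,0} → (ℋ / ℋ^{1,0}) ⊗ Ω¹_B` is the second fundamental form
of `ℋ^{1,0} ⊆ ℋ` and `s` is a local section of `ℋ^{1,0}` near `x`: the class of `∇_v s (x)` in
`ℋ_x / ℋ^{1,0}_x` vanishes for all `v ∈ T_x B`. -/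
def SecondFormVanishesAt (B : Set (EndV g)) (s : EndV g → DualC g) (x : EndV g) : Prop :=
  ∀ v ξ, IsNabla B s x v ξ → (hodge10 x).mkQ ξ = 0

/-- Sections over `A` of the kernel bundle `𝒦 = ker σ`. -/
structure IsKernelSection (B A : Set (EndV g)) (s : EndV g → DualC g) : Prop where
  section_hodge : IsHodgeSection B A s
  vanishes : ∀ x ∈ A, SecondFormVanishesAt B s x

/-- The fibre `𝒦_x = ker σ_x ⊆ ℋ^{1,0}_x`, where `σ_x(u)` is computed by extending `u` to a local
holomorphic section of `ℋ^{1,0}`. -/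
def kernelFibre (B : Set (EndV g)) (x : EndV g) : Set (DualC g) :=
  {u | ∃ A s, IsOpenIn B A ∧ x ∈ A ∧ IsHodgeSection B A s ∧ s x = u ∧
    SecondFormVanishesAt B s x}

/-- The sections over `A` of the sheaf `𝕌` of `∇^{hdg}`-flat sections of `ℋ^{1,0}`. Here
`∇^{hdg} = p ∘ ∇` with `p : ℋ → ℋ^{1,0}` the `h`-orthogonal projection, so that `p ξ = 0` means
that `ξ` is `h`-orthogonal to `ℋ^{1,0}_x`. -/
structure IsHodgeFlatSection (B A : Set (EndV g)) (s : EndV g → DualC g) : Prop where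
  smooth : IsSmoothOn B A s
  mem : ∀ x ∈ A, s x ∈ hodge10 x
  flat : ∀ x ∈ A, ∀ v ξ, IsNabla B s x v ξ → ∀ β ∈ hodge10 x, hodgeForm ξ β = 0

/-- Sections over `A` of the unitary flat bundle `𝒰 = 𝕌 ⊗ 𝒪_B ⊆ ℋ^{1,0}`: locally, finite
combinations of sections of `𝕌` with holomorphic coefficients. -/
def IsUnitaryFlatSection (B A : Set (EndV g)) (s : EndV g → DualC g) : Prop :=
  ∀ x ∈ A, ∃ A', IsOpenIn B A' ∧ x ∈ A' ∧ A' ⊆ A ∧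
    ∃ (n : ℕ) (f : Fin n → EndV g → ℂ) (u : Fin n → EndV g → DualC g),
      (∀ i, IsHolomorphicOn B A' (f i)) ∧ (∀ i, IsHodgeFlatSection B A' (u i)) ∧
      ∀ y ∈ A', s y = ∑ i, f i y • u i y

/-- The fibre `𝒰_x ⊆ ℋ^{1,0}_x`: the values at `x` of the local sections of `𝕌` near `x`. -/
def unitaryFlatFibre (B : Set (EndV g)) (x : EndV g) : Set (DualC g) :=
  {u | ∃ A s, IsOpenIn B A ∧ x ∈ A ∧ IsHodgeFlatSection B A s ∧ s x = u}

end SiegelVHS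

end

open scoped ContDiff Topology
open Filter

noncomputable section

namespace SiegelVHS

variable {g : ℕ}

/-! ### Positive definite forms and traces -/

/-! Differentiating the relation that defines `ℋ^{1,0}` shows that, for `X ∈ T_J B` and `u ∈
ℋ^{1,0}_J`, the class `σ(u)(X)` vanishes exactly when `u ∘ X = 0`. The proof compares this condition
with flatness.

The inclusion `𝒰 ⊆ 𝒦` holds on every complex curve. A `∇^{hdg}`-flat section `F` satisfies `dF =
-(i/2) F ∘ X`. Symmetry of second derivatives gives `F ∘ X_v X_w = F ∘ X_w X_v`. The choice `X_v = J
X_w` yields `F ∘ X_w² = 0`, hence `F ∘ X_w = 0`, because `X_w` is self-adjoint for `g_J`. So `F` is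
flat for `∇` and lies in `𝒦` (`IsLocalParam.comp_fderiv_eq_zero_of_flat`), and holomorphic
combinations of such sections stay in `𝒦`.

The inclusion `𝒦 ⊆ 𝒰` uses the geodesic. It is an orbit of a one-parameter group: `γ' = [A, γ]` with
a constant `A` that anticommutes with every `γ t` (`IsGeodesic.exists_generator`). Hence, along the
segment, `A²` commutes with `J` and the vector field `J ↦ [A, J]` is tangent to `B`. Both conditions
are expressed by the vanishing of holomorphic functions on `B`, so they propagate to all of the
connected curve (`IsComplexCurve.exists_isTangentFlow`).

At each `J ∈ B` the vector `[A, J]` then spans `T_J B` over `ℂ`, and, because `A²` commutes with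
`J`, a form `u` kills the image of `[A, J]` if and only if it kills the image of `A`. So `𝒦_J = {u ∈
ℋ^{1,0}_J : u ∘ A = 0}`, where the equation no longer depends on `J`. A form with `u ∘ A = 0` that
is of type `(1,0)` at one point remains so nearby (`mem_hodge10_of_ball`), so `𝒦` is locally spanned
by constant sections, which are flat. -/

theorem trace_adjoint_comp {E : Type*} [AddCommGroup E] [Module ℝ E] [FiniteDimensional ℝ E]
    (G : LinearMap.BilinForm ℝ E) (hs : ∀ x y, G x y = G y x) (hp : ∀ x, x ≠ 0 → 0 < G x x)
    (S T : E →ₗ[ℝ] E) (hST : ∀ x y, G (S x) y = G x (T y)) :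
    0 ≤ LinearMap.trace ℝ E (S * T) ∧ (LinearMap.trace ℝ E (S * T) = 0 → T = 0) := by
  obtain ⟨v, hv⟩ := LinearMap.BilinForm.exists_orthogonal_basis (B := G) ⟨fun x y => hs x y⟩
  have hvi : ∀ i, 0 < G (v i) (v i) := fun i => hp _ (v.ne_zero i)
  have hrepr : ∀ x i, G x (v i) = v.repr x i * G (v i) (v i) := by
    intro x i
    conv_lhs => rw [← v.sum_repr x]
    rw [map_sum, LinearMap.sum_apply, Finset.sum_eq_single i]
    · simp
    · intro j _ hj
      have := hv hj
      simp only [Function.onFun] at this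
      rw [map_smul, LinearMap.smul_apply, this, smul_zero]
    · simp
  -- In a `G`-orthogonal basis the diagonal entries of `S T` are `G(STv, v) / G(v, v)`, and
  -- adjointness turns the numerator into `G(Tv, Tv)`.
  have htr : LinearMap.trace ℝ E (S * T) = ∑ i, G (T (v i)) (T (v i)) / G (v i) (v i) := by
    rw [LinearMap.trace_eq_matrix_trace ℝ v, Matrix.trace]
    refine Finset.sum_congr rfl fun i _ => ?_
    rw [Matrix.diag_apply, LinearMap.toMatrix_apply, eq_div_iff (hvi i).ne', ← hrepr]
    exact hST _ _
  have hnn : ∀ x, 0 ≤ G x x := fun x => by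
    by_cases h : x = 0
    · simp [h]
    · exact (hp x h).le
  have hterm : ∀ i ∈ Finset.univ, 0 ≤ G (T (v i)) (T (v i)) / G (v i) (v i) :=
    fun i _ => div_nonneg (hnn _) (hvi i).le
  rw [htr]
  refine ⟨Finset.sum_nonneg hterm, fun h0 => v.ext fun i => ?_⟩
  have := (Finset.sum_eq_zero_iff_of_nonneg hterm).1 h0 i (Finset.mem_univ i)
  by_contra hne
  exact (div_pos (hp _ hne) (hvi i)).ne' this

/-- Symmetry for `G` forces `tr T² ≥ 0`, skewness for `G'` forces `tr T² ≤ 0`, and `tr T² = 0`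
forces `T = 0` by the equality case for `G`. -/
theorem eq_zero_of_symm_of_skew {E : Type*} [AddCommGroup E] [Module ℝ E] [FiniteDimensional ℝ E]
    (G G' : LinearMap.BilinForm ℝ E) (hs : ∀ x y, G x y = G y x) (hp : ∀ x, x ≠ 0 → 0 < G x x)
    (hs' : ∀ x y, G' x y = G' y x) (hp' : ∀ x, x ≠ 0 → 0 < G' x x)
    (T : E →ₗ[ℝ] E) (hT : ∀ x y, G (T x) y = G x (T y)) (hT' : ∀ x y, G' (T x) y = -G' x (T y)) :
    T = 0 := by
  have h1 := trace_adjoint_comp G hs hp T T hT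
  have h2 := trace_adjoint_comp G' hs' hp' (-T) T (fun x y => by simp [hT'])
  rw [neg_mul, map_neg] at h2
  exact h1.2 (by linarith [h1.1, h2.1])

/-! ### The symplectic form -/

def omegaBilin : LinearMap.BilinForm ℝ (V g) :=
  LinearMap.mk₂ ℝ omega
    (fun x x' y => by
      simp only [omega, Pi.add_apply, ← Finset.sum_add_distrib]
      exact Finset.sum_congr rfl fun i _ => by ring)
    (fun c x y => by
      simp only [omega, Pi.smul_apply, smul_eq_mul, Finset.mul_sum]
      exact Finset.sum_congr rfl fun i _ => by ring)
    (fun x y y' => by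
      simp only [omega, Pi.add_apply, ← Finset.sum_add_distrib]
      exact Finset.sum_congr rfl fun i _ => by ring)
    (fun c x y => by
      simp only [omega, Pi.smul_apply, smul_eq_mul, Finset.mul_sum]
      exact Finset.sum_congr rfl fun i _ => by ring)

theorem omega_add_left (x x' y : V g) : omega (x + x') y = omega x y + omega x' y :=
  LinearMap.map_add₂ omegaBilin x x' y
theorem omega_add_right (x y y' : V g) : omega x (y + y') = omega x y + omega x y' :=
  map_add (omegaBilin x) y y'
theorem omega_neg_left (x y : V g) : omega (-x) y = -omega x y :=
  LinearMap.map_neg₂ omegaBilin x y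
theorem omega_neg_right (x y : V g) : omega x (-y) = -omega x y :=
  map_neg (omegaBilin x) y
theorem omega_sub_left (x x' y : V g) : omega (x - x') y = omega x y - omega x' y :=
  LinearMap.map_sub₂ omegaBilin x x' y
theorem omega_sub_right (x y y' : V g) : omega x (y - y') = omega x y - omega x y' :=
  map_sub (omegaBilin x) y y'
theorem omega_smul_left (c : ℝ) (x y : V g) : omega (c • x) y = c * omega x y :=
  LinearMap.map_smul₂ omegaBilin c x y
theorem omega_smul_right (c : ℝ) (x y : V g) : omega x (c • y) = c * omega x y :=
  map_smul (omegaBilin x) c y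
theorem omega_swap (x y : V g) : omega x y = -omega y x := by
  simp only [omega, ← Finset.sum_neg_distrib]
  exact Finset.sum_congr rfl fun i _ => by ring
@[simp] theorem omega_zero_left (y : V g) : omega 0 y = 0 := LinearMap.map_zero₂ omegaBilin y
@[simp] theorem omega_zero_right (x : V g) : omega x 0 = 0 := map_zero (omegaBilin x)

/-- Endomorphisms in the symplectic Lie algebra. -/
def IsSymplecticSkew (X : EndV g) : Prop := ∀ x y, omega (X x) y = -omega x (X y)

theorem IsSymplecticSkew.commutator {X Y : EndV g} (hX : IsSymplecticSkew X)
    (hY : IsSymplecticSkew Y) : IsSymplecticSkew (X * Y - Y * X) := by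
  intro x y
  simp only [sub_apply, mul_apply_eq_comp, omega_sub_left, omega_sub_right]
  rw [hX, hY, hY, hX, neg_neg, neg_neg]
  ring

theorem exists_omega_eq (r : V g →ₗ[ℝ] ℝ) : ∃ a : V g, ∀ y, omega a y = r y := by
  refine ⟨Sum.elim (fun i => r (Pi.single (Sum.inr i) 1)) (fun i => -r (Pi.single (Sum.inl i) 1)),
    fun y => ?_⟩
  conv_rhs => rw [LinearMap.pi_apply_eq_sum_univ r y]
  simp only [omega, Fintype.sum_sum_type, Sum.elim_inl, Sum.elim_inr, smul_eq_mul,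
    ← Finset.sum_add_distrib]
  refine Finset.sum_congr rfl fun i _ => ?_
  have h : ∀ k : Fin g ⊕ Fin g, (fun j => if k = j then (1 : ℝ) else 0) = Pi.single k 1 := by
    intro k; ext j; simp [Pi.single_apply, eq_comm]
  rw [h, h]; ring

theorem eq_zero_of_omega_eq_zero {x : V g} (h : ∀ y, omega x y = 0) : x = 0 := by
  ext j
  obtain ⟨a, ha⟩ := exists_omega_eq (LinearMap.proj (R := ℝ) (φ := fun _ : Fin g ⊕ Fin g => ℝ) j)
  have := ha x
  rw [omega_swap, h] at this
  simpa using this.symm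

/-! ### Points and tangent vectors of Siegel space -/

theorem siegel_mul_self {J : EndV g} (hJ : J ∈ siegelSpace g) : J * J = -1 := by
  ext1 x; exact hJ.1 x

theorem siegel_skew {J : EndV g} (hJ : J ∈ siegelSpace g) : IsSymplecticSkew J := by
  intro x y
  have := hJ.2.1 x (J y)
  rw [hJ.1, omega_neg_right] at this
  linarith

theorem mem_tangentSpace_iff {J X : EndV g} :
    X ∈ tangentSpace J ↔ X * J = -(J * X) ∧ IsSymplecticSkew X := by
  constructor
  · rintro ⟨h1, h2⟩
    exact ⟨ContinuousLinearMap.ext fun x => eq_neg_of_add_eq_zero_left (h1 x),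
      fun x y => eq_neg_of_add_eq_zero_left (h2 x y)⟩
  · rintro ⟨h1, h2⟩
    exact ⟨fun x => by simpa using eq_neg_iff_add_eq_zero.1 (congrArg (fun T : EndV g => T x) h1),
      fun x y => by rw [h2]; ring⟩

/-- The metric `g_J(x, y) = ω(x, J y)`. -/
def metric (J : EndV g) : LinearMap.BilinForm ℝ (V g) :=
  omegaBilin.compl₂ (J : V g →ₗ[ℝ] V g)

@[simp] theorem metric_apply (J : EndV g) (x y : V g) : metric J x y = omega x (J y) := rfl

theorem metric_symm {J : EndV g} (hJ : J ∈ siegelSpace g) (x y : V g) :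
    metric J x y = metric J y x := by
  simp only [metric_apply]
  rw [omega_swap, siegel_skew hJ, neg_neg]

theorem metric_self_adjoint {J X : EndV g} (hX : X ∈ tangentSpace J) (x y : V g) :
    metric J (X x) y = metric J x (X y) := by
  rw [mem_tangentSpace_iff] at hX
  have := congrArg (fun T : EndV g => T y) hX.1
  simp only [mul_apply_eq_comp, neg_apply] at this
  simp only [metric_apply]
  rw [hX.2, this, omega_neg_right, neg_neg]

theorem eq_zero_of_traceForm_self {J X : EndV g} (hJ : J ∈ siegelSpace g)
    (hX : X ∈ tangentSpace J) (h : traceForm X X = 0) : X = 0 := by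
  have := (trace_adjoint_comp (metric J) (metric_symm hJ) hJ.2.2 (X : V g →ₗ[ℝ] V g) X
    (metric_self_adjoint hX)).2 h
  ext1 x
  exact congrArg (fun T : V g →ₗ[ℝ] V g => T x) this

theorem mul_self_apply_eq_zero {J X : EndV g} (hJ : J ∈ siegelSpace g) (hX : X ∈ tangentSpace J)
    {x : V g} (h : X (X x) = 0) : X x = 0 := by
  by_contra hne
  have h1 := hJ.2.2 _ hne
  have h2 := metric_self_adjoint hX x (X x)
  rw [h, map_zero] at h2
  exact h1.ne' h2

/-- A form that kills the image of `X ^ 2` kills the image of `X`, if `X` is tangent to Siegel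
space. -/
theorem comp_eq_zero_of_comp_mul_self {J X : EndV g} (hJ : J ∈ siegelSpace g)
    (hX : X ∈ tangentSpace J) {α : DualC g} (h : α.comp (X * X) = 0) : α.comp X = 0 := by
  obtain ⟨f, hf⟩ : ∃ f : V g →ₗ[ℝ] V g, ∀ x, f x = X x := ⟨(X : V g →ₗ[ℝ] V g), fun _ => rfl⟩
  -- `X` is self-adjoint for `g_J`, so `X²` and `X` have the same kernel; by rank-nullity they also
  -- have the same image.
  have hker : LinearMap.ker (f ∘ₗ f) = LinearMap.ker f := by
    ext x
    simp only [LinearMap.mem_ker, LinearMap.comp_apply, hf]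
    exact ⟨fun hx => mul_self_apply_eq_zero hJ hX hx, fun hx => by rw [hx, map_zero]⟩
  have hle : LinearMap.range (f ∘ₗ f) ≤ LinearMap.range f := LinearMap.range_comp_le_range _ _
  have heq := Submodule.eq_of_le_of_finrank_eq hle (by
    have h1 := LinearMap.finrank_range_add_finrank_ker (f ∘ₗ f)
    have h2 := LinearMap.finrank_range_add_finrank_ker f
    rw [hker] at h1
    omega)
  ext1 x
  have hx : f x ∈ LinearMap.range (f ∘ₗ f) := by
    rw [heq]; exact ⟨x, rfl⟩
  obtain ⟨y, hy⟩ := hx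
  rw [LinearMap.comp_apply, hf, hf, hf] at hy
  have := congrArg (fun T : DualC g => T y) h
  calc α (X x) = α (X (X y)) := congrArg α hy.symm
    _ = 0 := this

/-! ### Derivatives of maps into Siegel space -/

theorem HasFDerivAt.apply_eq_zero_of_const {E F G : Type*} [NormedAddCommGroup E] [NormedSpace ℝ E]
    [NormedAddCommGroup F] [NormedSpace ℝ F] [NormedAddCommGroup G] [NormedSpace ℝ G]
    {c : E → F} {c' : E →L[ℝ] F} {e : E} (hc : HasFDerivAt c c' e) (L : F →L[ℝ] G) {k : G}
    (h : ∀ᶠ y in 𝓝 e, L (c y) = k) (w : E) : L (c' w) = 0 := by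
  have h1 : HasFDerivAt (fun y => L (c y)) (L.comp c') e := L.hasFDerivAt.comp e hc
  have h2 : HasFDerivAt (fun y => L (c y)) (0 : E →L[ℝ] G) e :=
    (hasFDerivAt_const k e).congr_of_eventuallyEq h
  exact congrArg (fun T : E →L[ℝ] G => T w) (h1.unique h2)

/-- The linear conditions that define the symplectic Lie algebra. -/
def skewDefect (x y : V g) : EndV g →L[ℝ] ℝ :=
  LinearMap.toContinuousLinearMap
    ((omegaBilin.flip y) ∘ₗ (ContinuousLinearMap.apply ℝ (V g) x : EndV g →ₗ[ℝ] V g) +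
      (omegaBilin x) ∘ₗ (ContinuousLinearMap.apply ℝ (V g) y : EndV g →ₗ[ℝ] V g))

theorem skewDefect_apply (x y : V g) (X : EndV g) :
    skewDefect x y X = omega (X x) y + omega x (X y) := rfl

theorem isSymplecticSkew_iff {X : EndV g} :
    IsSymplecticSkew X ↔ ∀ x y, skewDefect x y X = 0 := by
  simp only [skewDefect_apply, IsSymplecticSkew, add_eq_zero_iff_eq_neg]

theorem fderiv_mem_tangentSpace {E : Type*} [NormedAddCommGroup E] [NormedSpace ℝ E]
    {c : E → EndV g} {c' : E →L[ℝ] EndV g} {e : E} (hc : HasFDerivAt c c' e)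
    (h : ∀ᶠ y in 𝓝 e, c y ∈ siegelSpace g) (w : E) : c' w ∈ tangentSpace (c e) := by
  rw [mem_tangentSpace_iff]
  constructor
  · have h2 : HasFDerivAt (c * c) (0 : E →L[ℝ] EndV g) e :=
      (hasFDerivAt_const (-1 : EndV g) e).congr_of_eventuallyEq
        (h.mono fun y hy => siegel_mul_self hy)
    have := congrArg (fun T : E →L[ℝ] EndV g => T w) ((hc.mul' hc).unique h2)
    simp only [add_apply, smul_apply, smul_eq_mul, zero_apply, MulOpposite.smul_eq_mul_unop,
      MulOpposite.unop_op] at this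
    exact eq_neg_of_add_eq_zero_right this
  · rw [isSymplecticSkew_iff]
    intro x y
    refine HasFDerivAt.apply_eq_zero_of_const hc (skewDefect x y) (k := 0) (h.mono fun z hz => ?_) w
    exact isSymplecticSkew_iff.1 (siegel_skew hz) x y

/-! ### Local parametrizations -/

section Param
variable {B : Set (EndV g)} {D : Set ℂ} {φ : ℂ → EndV g}

theorem IsLocalParam.mem (h : IsLocalParam B D φ) {z : ℂ} (hz : z ∈ D) : φ z ∈ B := by
  obtain ⟨W, _, hW⟩ := h.open_image
  exact (hW.subset ⟨z, hz, rfl⟩).1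

theorem IsLocalParam.contDiffAt (h : IsLocalParam B D φ) {z : ℂ} (hz : z ∈ D) :
    ContDiffAt ℝ ∞ φ z := h.smooth.contDiffAt (h.isOpen.mem_nhds hz)

theorem IsLocalParam.hasFDerivAt (h : IsLocalParam B D φ) {z : ℂ} (hz : z ∈ D) :
    HasFDerivAt φ (fderiv ℝ φ z) z :=
  ((h.contDiffAt hz).differentiableAt (by simp)).hasFDerivAt

theorem IsLocalParam.fderiv_mem_tangentSpace (h : IsLocalParam B D φ) (hB : B ⊆ siegelSpace g)
    {z : ℂ} (hz : z ∈ D) (w : ℂ) : fderiv ℝ φ z w ∈ tangentSpace (φ z) :=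
  SiegelVHS.fderiv_mem_tangentSpace (h.hasFDerivAt hz)
    ((h.isOpen.eventually_mem hz).mono fun _ hy => hB (h.mem hy)) w

/-- The tangent vectors of a holomorphic parametrization are complex multiples of one. -/
theorem IsLocalParam.fderiv_mul (h : IsLocalParam B D φ) {z : ℂ} (hz : z ∈ D) (c w : ℂ) :
    fderiv ℝ φ z (c * w) = c.re • fderiv ℝ φ z w + c.im • (φ z * fderiv ℝ φ z w) := by
  have h1 : c * w = (c.re : ℝ) • w + (c.im : ℝ) • (Complex.I * w) := by
    conv_lhs => rw [← Complex.re_add_im c]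
    simp only [Complex.real_smul]; ring
  rw [h1, map_add, map_smul, map_smul, h.holomorphic z hz w]
  rfl

theorem IsLocalParam.restrict (h : IsLocalParam B D φ) {D' : Set ℂ} (hD' : IsOpen D')
    (hsub : D' ⊆ D) : IsLocalParam B D' φ where
  isOpen := hD'
  smooth := h.smooth.mono hsub
  holomorphic z hz := h.holomorphic z (hsub hz)
  immersion z hz := h.immersion z (hsub hz)
  embedding := h.embedding.comp (Topology.IsEmbedding.inclusion hsub)
  open_image := by
    obtain ⟨W, hW, hWe⟩ := h.open_image
    have h1 : IsOpen ((Subtype.val : D → ℂ) ⁻¹' D') := hD'.preimage continuous_subtype_val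
    obtain ⟨U, hU, hUe⟩ := h.embedding.isOpen_iff.1 h1
    refine ⟨W ∩ U, hW.inter hU, ?_⟩
    ext x
    constructor
    · rintro ⟨z, hz, rfl⟩
      have h2 : φ z ∈ B ∩ W := hWe ▸ ⟨z, hsub hz, rfl⟩
      have h3 : (⟨z, hsub hz⟩ : D) ∈ D.domRestrict φ ⁻¹' U := by rw [hUe]; exact hz
      exact ⟨h2.1, h2.2, h3⟩
    · rintro ⟨hx, hxW, hxU⟩
      have h2 : x ∈ φ '' D := hWe ▸ ⟨hx, hxW⟩
      obtain ⟨z, hz, rfl⟩ := h2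
      have h3 : (⟨z, hz⟩ : D) ∈ D.domRestrict φ ⁻¹' U := hxU
      rw [hUe] at h3
      exact ⟨z, h3, rfl⟩

theorem IsLocalParam.isOpenIn (h : IsLocalParam B D φ) : IsOpenIn B (φ '' D) := h.open_image

/-- A parametrization can be restricted to the preimage of an open subset of the curve. -/
theorem IsLocalParam.exists_restrict (h : IsLocalParam B D φ) {A : Set (EndV g)}
    (hA : IsOpenIn B A) {z : ℂ} (hz : z ∈ D) (hzA : φ z ∈ A) :
    ∃ r > 0, IsLocalParam B (Metric.ball z r) φ ∧ Metric.ball z r ⊆ D ∧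
      Set.MapsTo φ (Metric.ball z r) A := by
  obtain ⟨W, hW, rfl⟩ := hA
  have h1 : ∀ᶠ y in 𝓝 z, y ∈ D ∧ φ y ∈ W :=
    (h.isOpen.eventually_mem hz).and ((h.hasFDerivAt hz).continuousAt (hW.mem_nhds hzA.2))
  obtain ⟨r, hr, hball⟩ := Metric.eventually_nhds_iff_ball.1 h1
  exact ⟨r, hr, h.restrict Metric.isOpen_ball fun y hy => (hball y hy).1,
    fun y hy => (hball y hy).1, fun y hy => ⟨h.mem (hball y hy).1, (hball y hy).2⟩⟩

/-- Every point of the curve is the centre of a parametrization by a disc. -/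
theorem IsComplexCurve.exists_ball (hB : IsComplexCurve B) {A : Set (EndV g)} (hA : IsOpenIn B A)
    {x : EndV g} (hx : x ∈ A) : ∃ φ z r, 0 < r ∧ IsLocalParam B (Metric.ball z r) φ ∧ φ z = x ∧
      Set.MapsTo φ (Metric.ball z r) A := by
  obtain ⟨W, hW, rfl⟩ := id hA
  obtain ⟨D, φ, h, z, hz, rfl⟩ := hB.exists_param x hx.1
  obtain ⟨r, hr, h1, -, h2⟩ := h.exists_restrict hA hz hx
  exact ⟨φ, z, r, hr, h1, rfl, h2⟩

/-- A differentiable map into the curve factors, locally and to first order, through a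
parametrization. -/
theorem IsLocalParam.exists_lift (h : IsLocalParam B D φ) {E : Type*} [NormedAddCommGroup E]
    [NormedSpace ℝ E] {c : E → EndV g} {c' : E →L[ℝ] EndV g} {e : E} (hc : HasFDerivAt c c' e)
    (hcB : ∀ᶠ y in 𝓝 e, c y ∈ B) {z : ℂ} (hz : z ∈ D) (hze : φ z = c e) :
    ∃ (ζ : E → ℂ) (ζ' : E →L[ℝ] ℂ), ζ e = z ∧ HasFDerivAt ζ ζ' e ∧
      (∀ᶠ y in 𝓝 e, ζ y ∈ D ∧ φ (ζ y) = c y) ∧ c' = (fderiv ℝ φ z).comp ζ' := by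
  classical
  obtain ⟨W, hW, hWe⟩ := h.open_image
  have hev : ∀ᶠ y in 𝓝 e, c y ∈ φ '' D := by
    have h1 : c e ∈ W := by
      rw [← hze]; exact (hWe.subset ⟨z, hz, rfl⟩).2
    filter_upwards [hcB, hc.continuousAt (hW.mem_nhds h1)] with y hy1 hy2
    rw [hWe]; exact ⟨hy1, hy2⟩
  -- A set-theoretic lift, continuous at `e` because `φ` is an embedding. The value `z` where no
  -- preimage exists is irrelevant: this does not happen near `e`.
  let ζ₀ : E → D := fun y => if hy : ∃ d ∈ D, φ d = c y then ⟨hy.choose, hy.choose_spec.1⟩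
    else ⟨z, hz⟩
  have hζ₀ : ∀ᶠ y in 𝓝 e, φ (ζ₀ y) = c y := by
    filter_upwards [hev] with y hy
    have hy' : ∃ d ∈ D, φ d = c y := hy
    simp only [ζ₀, dif_pos hy']
    exact hy'.choose_spec.2
  have hζe : ζ₀ e = ⟨z, hz⟩ := h.embedding.injective (by
    change φ (ζ₀ e) = φ z
    rw [hze]; exact hζ₀.self_of_nhds)
  have hcont : Tendsto ζ₀ (𝓝 e) (𝓝 ⟨z, hz⟩) := by
    rw [h.embedding.tendsto_nhds_iff]
    change Tendsto (fun y => φ (ζ₀ y)) (𝓝 e) (𝓝 (φ z))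
    rw [hze]
    exact hc.continuousAt.tendsto.congr' (hζ₀.mono fun y hy => hy.symm)
  have hcont' : Tendsto (fun y => (ζ₀ y : ℂ)) (𝓝 e) (𝓝 z) :=
    (continuous_subtype_val.tendsto _).comp hcont
  -- A linear left inverse of `dφ_z` makes `L ∘ φ` a local diffeomorphism of `ℂ`. Its local inverse
  -- applied to `L ∘ c` is a differentiable formula for the lift `ζ₀`.
  obtain ⟨L, hL⟩ := LinearMap.exists_leftInverse_of_injective
    (fderiv ℝ φ z : ℂ →ₗ[ℝ] EndV g) (LinearMap.ker_eq_bot.2 (h.immersion z hz))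
  have hL' : ∀ w, L (fderiv ℝ φ z w) = w := fun w => congrArg (fun T : ℂ →ₗ[ℝ] ℂ => T w) hL
  let L' : EndV g →L[ℝ] ℂ := LinearMap.toContinuousLinearMap L
  have hstrict : HasStrictFDerivAt φ (fderiv ℝ φ z) z :=
    (h.contDiffAt hz).hasStrictFDerivAt (by simp)
  have hψ : HasStrictFDerivAt (fun y => L' (φ y))
      ((ContinuousLinearEquiv.refl ℝ ℂ : ℂ ≃L[ℝ] ℂ) : ℂ →L[ℝ] ℂ) z := by
    have := L'.hasStrictFDerivAt.comp z hstrict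
    have h2 : L'.comp (fderiv ℝ φ z) =
      ((ContinuousLinearEquiv.refl ℝ ℂ : ℂ ≃L[ℝ] ℂ) : ℂ →L[ℝ] ℂ) := ContinuousLinearMap.ext hL'
    rw [← h2]; exact this
  let ζ : E → ℂ := fun y => hψ.localInverse _ _ _ (L' (c y))
  have hζζ₀ : ∀ᶠ y in 𝓝 e, ζ y = ζ₀ y := by
    filter_upwards [hcont'.eventually hψ.eventually_left_inverse, hζ₀] with y h1 h2
    simp only [ζ]
    rw [← h2]; exact h1
  have hζd : HasFDerivAt ζ (L'.comp c') e := by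
    have h1 := hψ.to_localInverse.hasFDerivAt
    rw [hze] at h1
    have h2 := h1.comp e (L'.hasFDerivAt.comp e hc)
    exact h2
  have hζz : ζ e = z := by rw [hζζ₀.self_of_nhds, hζe]
  have hev2 : ∀ᶠ y in 𝓝 e, ζ y ∈ D ∧ φ (ζ y) = c y := by
    filter_upwards [hζζ₀, hζ₀] with y h1 h2
    rw [h1]; exact ⟨(ζ₀ y).2, h2⟩
  refine ⟨ζ, L'.comp c', hζz, hζd, hev2, ?_⟩
  have h1 : HasFDerivAt (fun y => φ (ζ y)) ((fderiv ℝ φ z).comp (L'.comp c')) e := by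
    have := h.hasFDerivAt hz
    rw [← hζz] at this
    have := this.comp e hζd
    rwa [hζz] at this
  exact (hc.congr_of_eventuallyEq (hev2.mono fun y hy => hy.2)).unique h1

/-- The tangent space of the curve, seen in any parametrization. -/
theorem IsLocalParam.exists_fderiv_eq (h : IsLocalParam B D φ) {D' : Set ℂ} {ψ : ℂ → EndV g}
    (h' : IsLocalParam B D' ψ) {z z' : ℂ} (hz : z ∈ D) (hz' : z' ∈ D') (he : φ z = ψ z') (w : ℂ) :
    ∃ w', fderiv ℝ φ z w' = fderiv ℝ ψ z' w := by
  obtain ⟨ζ, ζ', -, -, -, h1⟩ := h.exists_lift (h'.hasFDerivAt hz')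
    ((h'.isOpen.eventually_mem hz').mono fun _ hy => h'.mem hy) hz he
  exact ⟨ζ' w, by rw [h1]; rfl⟩

end Param

/-! ### The Hodge form -/

theorem mem_hodge10_iff {J : EndV g} {α : DualC g} :
    α ∈ hodge10 J ↔ ∀ x, α (J x) = Complex.I * α x := by
  refine forall_congr' fun x => ⟨fun h => ?_, fun h => ?_⟩
  · linear_combination (-Complex.I) * h + α (J x) * Complex.I_mul_I
  · rw [h]; linear_combination α x * Complex.I_mul_I

theorem omega_single_inl (x : V g) (i : Fin g) :
    omega x (Pi.single (Sum.inl i) 1) = -x (Sum.inr i) := by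
  simp [omega, Pi.single_apply]

theorem omega_single_inr (x : V g) (i : Fin g) :
    omega x (Pi.single (Sum.inr i) 1) = x (Sum.inl i) := by
  simp [omega, Pi.single_apply]

theorem exists_omega_repr (α : DualC g) :
    ∃ v v' : V g, ∀ x, α x = omega v x + Complex.I * omega v' x := by
  obtain ⟨v, hv⟩ := exists_omega_eq ((Complex.reCLM.comp α : V g →L[ℝ] ℝ) : V g →ₗ[ℝ] ℝ)
  obtain ⟨v', hv'⟩ := exists_omega_eq ((Complex.imCLM.comp α : V g →L[ℝ] ℝ) : V g →ₗ[ℝ] ℝ)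
  refine ⟨v, v', fun x => ?_⟩
  rw [hv, hv', mul_comm]
  exact (Complex.re_add_im (α x)).symm

theorem polarization_eq {α β : DualC g} {v v' w w' : V g}
    (hα : ∀ x, α x = omega v x + Complex.I * omega v' x)
    (hβ : ∀ x, β x = omega w x + Complex.I * omega w' x) :
    polarization α β = ((omega v w - omega v' w' : ℝ) : ℂ) +
      Complex.I * ((omega v w' + omega v' w : ℝ) : ℂ) := by
  simp only [polarization, hα, hβ, omega_single_inl, omega_single_inr]
  simp only [omega, Complex.ofReal_sub, Complex.ofReal_add, Complex.ofReal_sum, Finset.mul_sum,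
    ← Finset.sum_add_distrib, ← Finset.sum_sub_distrib]
  refine Finset.sum_congr rfl fun i _ => ?_
  push_cast
  linear_combination (v' (Sum.inl i) * w' (Sum.inr i) - v' (Sum.inr i) * w' (Sum.inl i) : ℂ) *
    Complex.I_mul_I

theorem omega_repr_comp {J : EndV g} (hJ : J ∈ siegelSpace g) {α : DualC g} {v v' : V g}
    (hα : ∀ x, α x = omega v x + Complex.I * omega v' x) (x : V g) :
    (α.comp J) x = omega (-J v) x + Complex.I * omega (-J v') x := by
  rw [ContinuousLinearMap.comp_apply, hα, omega_neg_left, omega_neg_left, siegel_skew hJ,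
    siegel_skew hJ, neg_neg, neg_neg]

theorem polarization_comp {J : EndV g} (hJ : J ∈ siegelSpace g) (α β : DualC g) :
    polarization (α.comp J) (β.comp J) = polarization α β := by
  obtain ⟨v, v', hα⟩ := exists_omega_repr α
  obtain ⟨w, w', hβ⟩ := exists_omega_repr β
  rw [polarization_eq hα hβ, polarization_eq (omega_repr_comp hJ hα) (omega_repr_comp hJ hβ)]
  simp only [omega_neg_left, omega_neg_right, neg_neg, hJ.2.1]

theorem eq_zero_of_hodgeForm_self {J : EndV g} (hJ : J ∈ siegelSpace g) {α : DualC g}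
    (hα : α ∈ hodge10 J) (h : hodgeForm α α = 0) : α = 0 := by
  obtain ⟨v, v', hv⟩ := exists_omega_repr α
  have hc : ∀ x, conjDual α x = omega v x + Complex.I * omega (-v') x := by
    intro x
    change (starRingEnd ℂ) (α x) = _
    rw [hv, omega_neg_left]
    simp
  have hv' : v' = J v := by
    have : ∀ y, omega (v' - J v) y = 0 := by
      intro y
      have h1 := mem_hodge10_iff.1 hα y
      rw [hv, hv] at h1
      have h2 := congrArg Complex.re h1
      simp at h2
      rw [omega_sub_left, siegel_skew hJ, h2]
      ring
    exact sub_eq_zero.1 (eq_zero_of_omega_eq_zero this)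
  have h0 : omega v (J v) = 0 := by
    rw [hodgeForm, polarization_eq hv hc] at h
    have := congrArg Complex.re h
    have hsw := omega_swap (J v) v
    simp only [hv', omega_neg_right] at this
    simp at this
    linarith
  have hv0 : v = 0 := by
    by_contra hne
    exact (hJ.2.2 v hne).ne' h0
  ext1 x
  rw [hv, hv', hv0]
  simp

theorem polarization_add_left (α β γ : DualC g) :
    polarization (α + β) γ = polarization α γ + polarization β γ := by
  simp only [polarization, add_apply, ← Finset.sum_add_distrib]
  exact Finset.sum_congr rfl fun i _ => by ring

theorem polarization_smul (c d : ℂ) (α β : DualC g) :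
    polarization (c • α) (d • β) = c * d * polarization α β := by
  simp only [polarization, smul_apply, smul_eq_mul, Finset.mul_sum]
  exact Finset.sum_congr rfl fun i _ => by ring

/-- The `h`-orthogonal complement of `ℋ^{1,0}` is contained in the conjugate of `ℋ^{1,0}`. -/
theorem comp_eq_of_hodgeForm_eq_zero {J : EndV g} (hJ : J ∈ siegelSpace g) {ξ : DualC g}
    (h : ∀ β ∈ hodge10 J, hodgeForm ξ β = 0) (x : V g) : ξ (J x) = -(Complex.I * ξ x) := by
  have hI := Complex.I_mul_I
  set η : DualC g := ξ + (-Complex.I) • ξ.comp J with hη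
  set ζ : DualC g := ξ + Complex.I • ξ.comp J with hζ
  have hηx : ∀ x, η x = ξ x - Complex.I * ξ (J x) := fun x => by
    simp only [hη, add_apply, smul_apply, ContinuousLinearMap.comp_apply, smul_eq_mul]; ring
  have hζx : ∀ x, ζ x = ξ x + Complex.I * ξ (J x) := fun x => rfl
  have hηm : η ∈ hodge10 J := by
    rw [mem_hodge10_iff]
    intro x
    rw [hηx, hηx, hJ.1, map_neg]
    linear_combination (ξ (J x)) * hI
  have hζJ : ζ.comp J = (-Complex.I) • ζ := by
    ext1 x
    rw [ContinuousLinearMap.comp_apply, smul_apply, smul_eq_mul, hζx, hζx, hJ.1, map_neg]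
    linear_combination (ξ (J x)) * hI
  have hcη : (conjDual η).comp J = (-Complex.I) • conjDual η := by
    ext1 x
    change (starRingEnd ℂ) (η (J x)) = -Complex.I * (starRingEnd ℂ) (η x)
    rw [mem_hodge10_iff.1 hηm, map_mul, Complex.conj_I]
  -- Composition with `J` preserves `𝒬` but multiplies both arguments by `-i`, so `𝒬` equals its own
  -- negative here.
  have hζη : polarization ζ (conjDual η) = 0 := by
    have := polarization_comp hJ ζ (conjDual η)
    rw [hζJ, hcη, polarization_smul] at this
    linear_combination (-1 / 2 : ℂ) * this - (1 / 2 : ℂ) * hI * polarization ζ (conjDual η) +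
      hI * polarization ζ (conjDual η)
  have hηη : hodgeForm η η = 0 := by
    have h1 := h η hηm
    rw [hodgeForm] at h1 ⊢
    have h2 : polarization (η + ζ) (conjDual η) = 2 * polarization ξ (conjDual η) := by
      have : η + ζ = (2 : ℂ) • ξ := by
        ext1 x
        rw [add_apply, hηx, hζx, smul_apply, smul_eq_mul]; ring
      rw [this]
      have := polarization_smul 2 1 ξ (conjDual η)
      rwa [one_smul, mul_one] at this
    rw [polarization_add_left, hζη, add_zero] at h2
    rw [h2]
    linear_combination 2 * h1
  have h0 := eq_zero_of_hodgeForm_self hJ hηm hηη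
  have := hηx x
  rw [h0, zero_apply] at this
  linear_combination (-Complex.I) * this + ξ (J x) * hI

/-! ### Flat sections -/

section Sections
variable {B : Set (EndV g)} {D : Set ℂ} {φ : ℂ → EndV g}

/-- Differentiating the relation that defines `ℋ^{1,0}`. -/
theorem IsLocalParam.deriv_hodge_relation (h : IsLocalParam B D φ) {F : ℂ → DualC g} {z : ℂ}
    (hz : z ∈ D) {F' : ℂ →L[ℝ] DualC g} (hF : HasFDerivAt F F' z)
    (hmem : ∀ y ∈ D, F y ∈ hodge10 (φ y)) (w : ℂ) (x : V g) :
    F' w (φ z x) + F z (fderiv ℝ φ z w x) = Complex.I * F' w x := by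
  have h1 := hF.clm_comp (h.hasFDerivAt hz)
  have h2 := hF.const_smul Complex.I
  have h3 : (fun y => (F y).comp (φ y)) =ᶠ[𝓝 z] Complex.I • F := by
    filter_upwards [h.isOpen.mem_nhds hz] with y hy
    ext1 x
    exact mem_hodge10_iff.1 (hmem y hy) x
  have h4 := congrArg (fun T : ℂ →L[ℝ] DualC g => T w x)
    (h1.unique (h2.congr_of_eventuallyEq h3))
  rw [add_comm]
  exact h4

/-- A `∇^{hdg}`-flat section is flat for `∇` and is killed by the second fundamental form. -/
theorem IsLocalParam.comp_fderiv_eq_zero_of_flat (h : IsLocalParam B D φ) (hB : B ⊆ siegelSpace g)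
    {F : ℂ → DualC g} (hF : ContDiffOn ℝ ∞ F D) (hmem : ∀ y ∈ D, F y ∈ hodge10 (φ y))
    (hflat : ∀ y ∈ D, ∀ w, ∀ β ∈ hodge10 (φ y), hodgeForm (fderiv ℝ F y w) β = 0)
    {z : ℂ} (hz : z ∈ D) (w : ℂ) :
    (F z).comp (fderiv ℝ φ z w) = 0 ∧ fderiv ℝ F z w = 0 := by
  have hI := Complex.I_mul_I
  have hFd : ∀ y ∈ D, HasFDerivAt F (fderiv ℝ F y) y := fun y hy =>
    ((hF.contDiffAt (h.isOpen.mem_nhds hy)).differentiableAt (by simp)).hasFDerivAt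
  -- Flatness puts `dF(w)` in the `(-i)`-eigenspace of composition with `J`; the differentiated
  -- relation `dF(w) ∘ J + F ∘ X = i dF(w)` then determines `dF(w)`.
  have key : ∀ y ∈ D, ∀ w, fderiv ℝ F y w =
      (-(Complex.I / 2)) • (F y).comp (fderiv ℝ φ y w) := by
    intro y hy w
    ext1 x
    have h1 := h.deriv_hodge_relation hy (hFd y hy) hmem w x
    have h2 := comp_eq_of_hodgeForm_eq_zero (hB (h.mem hy)) (hflat y hy w) x
    rw [smul_apply, ContinuousLinearMap.comp_apply, smul_eq_mul]
    linear_combination (Complex.I / 2) * h1 - (Complex.I / 2) * h2 + (fderiv ℝ F y w x) * hI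
  have hF2 : HasFDerivAt (fderiv ℝ F) (fderiv ℝ (fderiv ℝ F) z) z :=
    (((hF.contDiffAt (h.isOpen.mem_nhds hz)).fderiv_right (m := 1) (by norm_cast)).differentiableAt
      (by simp)).hasFDerivAt
  have hφ2 : HasFDerivAt (fderiv ℝ φ) (fderiv ℝ (fderiv ℝ φ) z) z :=
    (((h.contDiffAt hz).fderiv_right (m := 1) (by norm_cast)).differentiableAt
      (by simp)).hasFDerivAt
  have hFs : ∀ v w, fderiv ℝ (fderiv ℝ F) z v w = fderiv ℝ (fderiv ℝ F) z w v :=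
    ((hF.contDiffAt (h.isOpen.mem_nhds hz)).isSymmSndFDerivAt (by simp; norm_cast)).eq
  have hφs : ∀ v w, fderiv ℝ (fderiv ℝ φ) z v w = fderiv ℝ (fderiv ℝ φ) z w v :=
    ((h.contDiffAt hz).isSymmSndFDerivAt (by simp; norm_cast)).eq
  have key2 : ∀ v w, fderiv ℝ (fderiv ℝ F) z v w = (-(Complex.I / 2)) •
      ((F z).comp (fderiv ℝ (fderiv ℝ φ) z v w) + (fderiv ℝ F z v).comp (fderiv ℝ φ z w)) := by
    intro v w
    have h1 := hF2.clm_apply (hasFDerivAt_const w z)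
    have h2 := ((hFd z hz).clm_comp (hφ2.clm_apply (hasFDerivAt_const w z))).const_smul
      (-(Complex.I / 2))
    have h3 := h1.unique (h2.congr_of_eventuallyEq (by
      filter_upwards [h.isOpen.mem_nhds hz] with y hy
      exact key y hy w))
    have h4 := congrArg (fun T : ℂ →L[ℝ] DualC g => T v) h3
    simpa using h4
  -- The term with the second derivative of `φ` is symmetric and cancels; `key` replaces `dF(v)` in
  -- the other term.
  have key3 : ∀ v w, (F z).comp (fderiv ℝ φ z v * fderiv ℝ φ z w) =
      (F z).comp (fderiv ℝ φ z w * fderiv ℝ φ z v) := by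
    intro v w
    have h1 := hFs v w
    rw [key2, key2, hφs v w, key z hz, key z hz] at h1
    ext1 x
    have h2 := congrArg (fun T : DualC g => T x) h1
    simp only [smul_apply, add_apply, ContinuousLinearMap.comp_apply, smul_eq_mul] at h2
    simp only [ContinuousLinearMap.comp_apply, mul_apply_eq_comp]
    linear_combination (-4 : ℂ) * h2 + (F z (fderiv ℝ φ z v (fderiv ℝ φ z w x)) -
      F z (fderiv ℝ φ z w (fderiv ℝ φ z v x))) * hI
  have hX := h.fderiv_mem_tangentSpace hB hz w
  have hJF := mem_hodge10_iff.1 (hmem z hz)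
  have h0 : (F z).comp (fderiv ℝ φ z w) = 0 := by
    -- With `v = i w` and `X_v = J X`, `key3` reads `F J X² = F X J X = -F J X²`, and `F J = i F`,
    -- so `F X² = 0`.
    refine comp_eq_zero_of_comp_mul_self (hB (h.mem hz)) hX ?_
    ext1 x
    have h1 := congrArg (fun T : DualC g => T x) (key3 (Complex.I * w) w)
    rw [h.holomorphic z hz] at h1
    simp only [ContinuousLinearMap.comp_apply, mul_apply_eq_comp] at h1 ⊢
    have h2 := congrArg (fun T : EndV g => T (fderiv ℝ φ z w x)) (mem_tangentSpace_iff.1 hX).1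
    simp only [neg_apply, mul_apply_eq_comp] at h2
    rw [h2, map_neg, hJF] at h1
    rw [zero_apply]
    linear_combination (-Complex.I / 2) * h1 + F z (fderiv ℝ φ z w (fderiv ℝ φ z w x)) * hI
  refine ⟨h0, ?_⟩
  ext1 x
  have h1 := congrArg (fun T : DualC g => T x) h0
  rw [key z hz, smul_apply]
  exact (congrArg (fun c : ℂ => -(Complex.I / 2) • c) h1).trans (smul_zero _)

theorem IsHodgeFlatSection.comp_fderiv_eq_zero {A : Set (EndV g)} {s : EndV g → DualC g}
    (hs : IsHodgeFlatSection B A s) (hB : B ⊆ siegelSpace g) (h : IsLocalParam B D φ)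
    (hA : Set.MapsTo φ D A) {z : ℂ} (hz : z ∈ D) (w : ℂ) :
    (s (φ z)).comp (fderiv ℝ φ z w) = 0 ∧ fderiv ℝ (s ∘ φ) z w = 0 :=
  h.comp_fderiv_eq_zero_of_flat hB (F := s ∘ φ) (hs.smooth D φ h hA)
    (fun _ hy => hs.mem _ (hA hy))
    (fun y hy w => hs.flat _ (hA hy) _ _ ⟨D, φ, y, w, h, hy, rfl, rfl, rfl⟩) hz w

theorem IsHodgeFlatSection.hasFDerivAt {A : Set (EndV g)} {s : EndV g → DualC g}
    (hs : IsHodgeFlatSection B A s) (hB : B ⊆ siegelSpace g) (h : IsLocalParam B D φ)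
    (hA : Set.MapsTo φ D A) {z : ℂ} (hz : z ∈ D) :
    HasFDerivAt (s ∘ φ) (0 : ℂ →L[ℂ] DualC g) z := by
  have h1 : HasFDerivAt (s ∘ φ) (fderiv ℝ (s ∘ φ) z) z :=
    (((hs.smooth D φ h hA).contDiffAt (h.isOpen.mem_nhds hz)).differentiableAt (by simp)).hasFDerivAt
  refine hasFDerivAt_of_restrictScalars ℝ h1 (ContinuousLinearMap.ext fun w => ?_)
  exact (hs.comp_fderiv_eq_zero hB h hA hz w).2.symm

end Sections

/-! ### Identities in rings with a complex structure -/

section Ring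
variable {R : Type*} [Ring R] {J : R}

theorem mul_mul_mul_of_sq_neg_one (hJ : J * J = -1) {N T : R} (hN : N * J = J * N)
    (hT : T * J = -(J * T)) : J * (N * T) * J = N * T := by
  calc J * (N * T) * J = J * N * (T * J) := by noncomm_ring
    _ = -(J * N * J * T) := by rw [hT]; noncomm_ring
    _ = -(N * (J * J) * T) := by rw [← hN]; noncomm_ring
    _ = N * T := by rw [hJ]; noncomm_ring

theorem mul_mul_of_sq_neg_one (hJ : J * J = -1) (Z : R) : J * (J * Z) = -Z := by
  rw [← mul_assoc, hJ, neg_one_mul]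

theorem mul_mul_of_sq_neg_one_right (hJ : J * J = -1) (Z : R) : Z * J * J = -Z := by
  rw [mul_assoc, hJ, mul_neg_one]

theorem add_conj_mul_of_sq_neg_one (hJ : J * J = -1) (Z : R) :
    (Z + J * Z * J) * J = -(J * (Z + J * Z * J)) := by
  rw [add_mul, mul_add, mul_mul_of_sq_neg_one_right hJ, mul_assoc J Z J, mul_mul_of_sq_neg_one hJ]
  abel

theorem sub_conj_mul_of_sq_neg_one (hJ : J * J = -1) (Z : R) :
    (Z - J * Z * J) * J = J * (Z - J * Z * J) := by
  rw [sub_mul, mul_sub, mul_mul_of_sq_neg_one_right hJ, mul_assoc J Z J, mul_mul_of_sq_neg_one hJ]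
  noncomm_ring

theorem commute_of_add_conj_eq_zero (hJ : J * J = -1) {Z : R} (h : Z + J * Z * J = 0) :
    Z * J = J * Z := by
  have h1 : (Z + J * Z * J) * J = 0 := by rw [h, zero_mul]
  rw [add_mul, mul_mul_of_sq_neg_one_right hJ] at h1
  exact sub_eq_zero.1 (by rw [← h1]; abel)

theorem mul_mul_of_anticommute (hJ : J * J = -1) {X : R} (hX : X * J = -(J * X)) :
    J * (X * J) = X := by
  rw [hX, mul_neg, mul_mul_of_sq_neg_one hJ, neg_neg]

theorem add_eq_zero_of_commute [Module ℝ R] {X Z : R} (h : Z * J + J * Z + 2 • (X * X) = 0)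
    (hZ : Z * J = J * Z) : Z * J + X * X = 0 := by
  rw [← hZ, ← two_nsmul, ← nsmul_add, ← Nat.cast_smul_eq_nsmul ℝ] at h
  exact (smul_eq_zero.1 h).resolve_left (by norm_num)

theorem anticommute_mul_add (J X Z : R) :
    Z * J + X * X + (X * X + J * Z) = Z * J + J * Z + 2 • (X * X) := by
  abel

end Ring

/-! ### Geodesics -/

theorem traceForm_add_left (X X' Y : EndV g) :
    traceForm (X + X') Y = traceForm X Y + traceForm X' Y := by
  rw [traceForm, traceForm, traceForm, ← map_add]
  congr 1

/-- Endomorphisms that commute with `J` are orthogonal to those that anticommute with `J`. -/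
theorem traceForm_eq_zero_of_commute {J N T : EndV g} (hJ : J * J = -1) (hN : N * J = J * N)
    (hT : T * J = -(J * T)) : traceForm N T = 0 := by
  have h1 : J * (N * T) * J = N * T := mul_mul_mul_of_sq_neg_one hJ hN hT
  have h2 : J * (J * (N * T)) = -(N * T) := mul_mul_of_sq_neg_one hJ _
  have h3 : traceForm J (J * (N * T)) = traceForm (J * (N * T)) J :=
    LinearMap.trace_mul_comm ℝ (J : V g →ₗ[ℝ] V g) ((J * (N * T) : EndV g) : V g →ₗ[ℝ] V g)
  have h4 : traceForm J (J * (N * T)) = -traceForm N T := by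
    change LinearMap.trace ℝ (V g) ((J * (J * (N * T)) : EndV g) : V g →ₗ[ℝ] V g) = _
    rw [h2]
    exact map_neg (LinearMap.trace ℝ (V g)) _
  have h5 : traceForm (J * (N * T)) J = traceForm N T := by
    change LinearMap.trace ℝ (V g) ((J * (N * T) * J : EndV g) : V g →ₗ[ℝ] V g) = _
    rw [h1]; rfl
  linarith

/-- Differentiating `γ² = -1` twice gives `γ''γ + γγ'' + 2(γ')² = 0`. The geodesic equation says
that `γ''` has no part anticommuting with `γ`, so `γ''γ + (γ')² = 0`. This is the derivative of
`γ'γ`, and the generator is the constant `-(1/2) γ'γ`. -/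
theorem IsGeodesic.exists_generator {γ : ℝ → EndV g} (h : IsGeodesic γ) :
    ∃ A : EndV g, A ∈ tangentSpace (γ 0) ∧
      ∀ t, HasDerivAt γ (A * γ t - γ t * A) t ∧ A * γ t = -(γ t * A) := by
  have hd : ∀ t, HasDerivAt γ (deriv γ t) t := fun t =>
    (h.contDiff.differentiable (by simp) t).hasDerivAt
  have hd2 : ∀ t, HasDerivAt (deriv γ) (deriv (deriv γ) t) t := fun t =>
    (((contDiff_infty_iff_deriv.1 h.contDiff).2).differentiable (by simp) t).hasDerivAt
  have hJ : ∀ t, γ t * γ t = -1 := fun t => siegel_mul_self (h.mem t)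
  have hX : ∀ t, deriv γ t ∈ tangentSpace (γ t) := by
    intro t
    have := fderiv_mem_tangentSpace (hd t).hasFDerivAt (Eventually.of_forall h.mem) 1
    simpa using this
  have hXJ : ∀ t, deriv γ t * γ t = -(γ t * deriv γ t) := fun t =>
    (mem_tangentSpace_iff.1 (hX t)).1
  have hacc : ∀ t, deriv (deriv γ) t * γ t + γ t * deriv (deriv γ) t +
      2 • (deriv γ t * deriv γ t) = 0 := by
    intro t
    have h1 := ((hd2 t).mul (hd t)).add ((hd t).mul (hd2 t))
    have h2 : HasDerivAt (deriv γ * γ + γ * deriv γ) 0 t := by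
      have : deriv γ * γ + γ * deriv γ = fun _ => (0 : EndV g) := by
        funext t
        simp [hXJ t]
      rw [this]; exact hasDerivAt_const t 0
    exact (anticommute_mul_add _ _ _).symm.trans (h1.unique h2)
  have hskew : ∀ t, IsSymplecticSkew (deriv (deriv γ) t) := by
    intro t
    rw [isSymplecticSkew_iff]
    intro x y
    have := HasFDerivAt.apply_eq_zero_of_const (hd2 t).hasFDerivAt (skewDefect x y) (k := 0)
      (Eventually.of_forall fun t =>
        isSymplecticSkew_iff.1 (mem_tangentSpace_iff.1 (hX t)).2 x y) 1
    simpa using this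
  have hode : ∀ t, deriv (deriv γ) t * γ t + deriv γ t * deriv γ t = 0 := by
    intro t
    set J := γ t with hJdef
    set X := deriv γ t with hXdef
    set Z := deriv (deriv γ) t with hZdef
    have hJJ : J * J = -1 := hJ t
    -- Twice the part of `Z` that anticommutes with `J`; since it is itself tangent, it can serve as
    -- the test vector in the geodesic equation.
    have hT : Z + J * Z * J ∈ tangentSpace J := by
      rw [mem_tangentSpace_iff]
      constructor
      · exact add_conj_mul_of_sq_neg_one hJJ Z
      · intro x y
        have hs := siegel_skew (h.mem t)
        simp only [add_apply, mul_apply_eq_comp, omega_add_left, omega_add_right]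
        rw [hskew t, hs, hskew t, hs, neg_neg]
        ring
    have hTJ := (mem_tangentSpace_iff.1 hT).1
    have hN : (Z - J * Z * J) * J = J * (Z - J * Z * J) := sub_conj_mul_of_sq_neg_one hJJ Z
    have h1 := traceForm_eq_zero_of_commute hJJ hN hTJ
    have h2 := h.covDeriv_eq_zero t _ hT
    have h3 : traceForm (Z + J * Z * J) (Z + J * Z * J) = 0 := by
      have e1 := traceForm_add_left (Z - J * Z * J) (Z + J * Z * J) (Z + J * Z * J)
      have e2 := traceForm_add_left Z Z (Z + J * Z * J)
      have e3 : Z - J * Z * J + (Z + J * Z * J) = Z + Z := by abel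
      rw [e3, e2, h1, h2] at e1
      linarith
    have h4 := eq_zero_of_traceForm_self (h.mem t) hT h3
    exact add_eq_zero_of_commute (hacc t) (commute_of_add_conj_eq_zero hJJ h4)
  set A : ℝ → EndV g := fun t => (-(1 / 2) : ℝ) • (deriv γ t * γ t) with hA
  have hconst : ∀ t, A t = A 0 := by
    have hdA : ∀ t, HasDerivAt A 0 t := by
      intro t
      have := ((hd2 t).mul (hd t)).const_smul (-(1 / 2) : ℝ)
      rw [hode t, smul_zero] at this
      exact this
    intro t
    exact is_const_of_deriv_eq_zero (fun t => (hdA t).differentiableAt)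
      (fun t => (hdA t).deriv) t 0
  have hAJ : ∀ t, A t * γ t = (1 / 2 : ℝ) • deriv γ t := by
    intro t
    simp only [hA]
    have h1 : deriv γ t * γ t * γ t = -deriv γ t := mul_mul_of_sq_neg_one_right (hJ t) _
    rw [smul_mul_assoc, h1, smul_neg, neg_smul, neg_neg]
  have hJA : ∀ t, γ t * A t = -((1 / 2 : ℝ) • deriv γ t) := by
    intro t
    simp only [hA]
    have h1 : γ t * (deriv γ t * γ t) = deriv γ t := mul_mul_of_anticommute (hJ t) (hXJ t)
    rw [mul_smul_comm, h1]
    exact neg_smul (1 / 2 : ℝ) (deriv γ t)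
  refine ⟨A 0, ?_, fun t => ⟨?_, ?_⟩⟩
  · rw [mem_tangentSpace_iff]
    refine ⟨by rw [hAJ, hJA, neg_neg], fun x y => ?_⟩
    have hs := siegel_skew (h.mem 0)
    have hx := (mem_tangentSpace_iff.1 (hX 0)).2
    have hc := congrArg (fun T : EndV g => T y) (hXJ 0)
    simp only [neg_apply, mul_apply_eq_comp] at hc
    simp only [hA, smul_apply, mul_apply_eq_comp, omega_smul_left, omega_smul_right]
    rw [hx, hs, hc, omega_neg_right]
    ring
  · have : A 0 * γ t - γ t * A 0 = deriv γ t := by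
      rw [← hconst t, hAJ, hJA, sub_neg_eq_add, ← add_smul]
      norm_num
    rw [this]; exact hd t
  · rw [← hconst t, hAJ, hJA, neg_neg]

/-! ### Endomorphisms whose square commutes with `J` -/

/-- If `A` is tangent at `J₀` and `A ^ 2` commutes with `J`, then the kernels of `[A, J]` and of
`A` coincide. -/
theorem apply_eq_zero_of_commutator {J₀ J A : EndV g} (hJ₀ : J₀ ∈ siegelSpace g)
    (hA : A ∈ tangentSpace J₀) (hJ : J ∈ siegelSpace g) (hc : A * A * J = J * (A * A)) {x : V g}
    (hx : A (J x) = J (A x)) : A x = 0 := by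
  let X : V g →ₗ[ℝ] V g := ((A * J - J * A : EndV g) : V g →ₗ[ℝ] V g)
  have hXmem : ∀ x, x ∈ LinearMap.ker X ↔ A (J x) = J (A x) := fun x => by
    rw [LinearMap.mem_ker]
    exact sub_eq_zero
  have hcx : ∀ x, A (A (J x)) = J (A (A x)) := fun x => congrArg (fun T : EndV g => T x) hc
  have hinv : ∀ x ∈ LinearMap.ker X, (A : V g →ₗ[ℝ] V g) x ∈ LinearMap.ker X := by
    intro x hx
    rw [hXmem] at hx ⊢
    change A (J (A x)) = J (A (A x))
    rw [← hx, hcx]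
  have hs := (mem_tangentSpace_iff.1 hA).2
  -- On `ker [A, J]`, which `A` preserves because `A²` commutes with `J`, the map `A` is symmetric
  -- for `g_{J₀}` and, as it commutes with `J` there, skew for `g_J`.
  have h0 := eq_zero_of_symm_of_skew
    ((metric J₀).compl₁₂ (LinearMap.ker X).subtype (LinearMap.ker X).subtype)
    ((metric J).compl₁₂ (LinearMap.ker X).subtype (LinearMap.ker X).subtype)
    (fun x y => metric_symm hJ₀ _ _)
    (fun x hx => hJ₀.2.2 _ (by simpa using hx))
    (fun x y => metric_symm hJ _ _)
    (fun x hx => hJ.2.2 _ (by simpa using hx))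
    ((A : V g →ₗ[ℝ] V g).restrict hinv)
    (fun x y => metric_self_adjoint hA _ _)
    (fun x y => by
      change omega (A x) (J y) = -omega x (J (A y))
      rw [hs, (hXmem y).1 y.2])
  have := congrArg (fun T : LinearMap.ker X →ₗ[ℝ] LinearMap.ker X =>
    ((T ⟨x, (hXmem x).2 hx⟩ : LinearMap.ker X) : V g)) h0
  exact this

/-- This is the dual of the statement on kernels: `A` and `[A, J]` are `ω`-skew, so `ω` turns real
forms killing their images into vectors of their kernels. -/
theorem comp_eq_zero_of_comp_commutator {J₀ J A : EndV g} (hJ₀ : J₀ ∈ siegelSpace g)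
    (hA : A ∈ tangentSpace J₀) (hJ : J ∈ siegelSpace g) (hc : A * A * J = J * (A * A))
    {u : DualC g} (hu : u.comp (A * J - J * A) = 0) : u.comp A = 0 := by
  have hs := (mem_tangentSpace_iff.1 hA).2
  have hXs := hs.commutator (siegel_skew hJ)
  have hreal : ∀ r : V g →ₗ[ℝ] ℝ, (∀ y, r ((A * J - J * A) y) = 0) → ∀ y, r (A y) = 0 := by
    intro r hr y
    obtain ⟨a, ha⟩ := exists_omega_eq r
    have h1 : (A * J - J * A) a = 0 := eq_zero_of_omega_eq_zero fun y => by
      rw [hXs, ha, hr, neg_zero]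
    have h2 := apply_eq_zero_of_commutator hJ₀ hA hJ hc (sub_eq_zero.1 h1)
    rw [← ha, ← neg_eq_zero, ← hs, h2, omega_zero_left]
  ext1 y
  have hu' : ∀ y, u ((A * J - J * A) y) = 0 := fun y => congrArg (fun T : DualC g => T y) hu
  refine Complex.ext ?_ ?_
  · exact hreal ((Complex.reCLM.comp u : V g →L[ℝ] ℝ) : V g →ₗ[ℝ] ℝ)
      (fun y => congrArg Complex.re (hu' y)) y
  · exact hreal ((Complex.imCLM.comp u : V g →L[ℝ] ℝ) : V g →ₗ[ℝ] ℝ)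
      (fun y => congrArg Complex.im (hu' y)) y

/-- From `u A = 0` follows `u J A² = u A² J = 0`, hence `u J A = 0` by self-adjointness of `A` for
`g_{J₀}`. -/
theorem comp_commutator_eq_zero_of_comp {J₀ J A : EndV g} (hJ₀ : J₀ ∈ siegelSpace g)
    (hA : A ∈ tangentSpace J₀) (hc : A * A * J = J * (A * A))
    {u : DualC g} (hu : u.comp A = 0) : u.comp (A * J - J * A) = 0 := by
  have hu' : ∀ y, u (A y) = 0 := fun y => congrArg (fun T : DualC g => T y) hu
  have h1 : (u.comp J).comp A = 0 := by
    refine comp_eq_zero_of_comp_mul_self hJ₀ hA ?_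
    ext1 x
    have := congrArg (fun T : EndV g => u (T x)) hc
    simp only [mul_apply_eq_comp] at this
    simp only [ContinuousLinearMap.comp_apply, mul_apply_eq_comp]
    rw [← this, hu', zero_apply]
  ext1 x
  have h2 := congrArg (fun T : DualC g => T x) h1
  simp only [ContinuousLinearMap.comp_apply, zero_apply] at h2
  simp only [ContinuousLinearMap.comp_apply, sub_apply, mul_apply_eq_comp, map_sub, hu', h2]
  simp

/-! ### A holomorphic frame of the Hodge bundle -/

theorem intertwine_of_sq_neg_one {R : Type*} [Ring R] {J J₁ M : R} (hJ : J * J = -1)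
    (hJ₁ : J₁ * J₁ = -1) (h1 : M * (J + J₁) = 1) (h2 : (J + J₁) * M = 1) :
    M * J = J₁ * M ∧ M * J₁ = J * M := by
  have e1 : J₁ * (J + J₁) = (J + J₁) * J := by rw [mul_add, add_mul, hJ, hJ₁]; abel
  have e2 : J * (J + J₁) = (J + J₁) * J₁ := by rw [mul_add, add_mul, hJ, hJ₁]; abel
  constructor
  · calc M * J = M * (J * (J + J₁)) * M := by rw [mul_assoc, mul_assoc, h2, mul_one]
      _ = J₁ * M := by rw [e2, ← mul_assoc, h1, one_mul]
  · calc M * J₁ = M * (J₁ * (J + J₁)) * M := by rw [mul_assoc, mul_assoc, h2, mul_one]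
      _ = J * M := by rw [e1, ← mul_assoc, h1, one_mul]

theorem isUnit_add {J J₁ : EndV g} (hJ : J ∈ siegelSpace g) (hJ₁ : J₁ ∈ siegelSpace g) :
    IsUnit (J + J₁) := by
  have hinj : Function.Injective ((J + J₁ : EndV g) : V g →ₗ[ℝ] V g) := by
    rw [← LinearMap.ker_eq_bot, LinearMap.ker_eq_bot']
    intro x hx
    by_contra hne
    have h1 := hJ.2.2 x hne
    have h2 := hJ₁.2.2 x hne
    have h3 : J x + J₁ x = 0 := hx
    have h4 : omega x (J x + J₁ x) = 0 := by rw [h3, omega_zero_right]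
    rw [omega_add_right] at h4
    linarith
  exact ⟨ContinuousLinearEquiv.toUnit
    (LinearEquiv.ofInjectiveEndo _ hinj).toContinuousLinearEquiv, ContinuousLinearMap.ext fun _ => rfl⟩

/-- The isomorphism that carries `ℋ^{1,0}_{J₁}` to `ℋ^{1,0}_J`, holomorphically in `J`. -/
def frame (J₁ J : EndV g) : EndV g := Ring.inverse (J + J₁)

theorem frame_mul {J J₁ : EndV g} (hJ : J ∈ siegelSpace g) (hJ₁ : J₁ ∈ siegelSpace g) :
    frame J₁ J * (J + J₁) = 1 := Ring.inverse_mul_cancel _ (isUnit_add hJ hJ₁)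

theorem mul_frame {J J₁ : EndV g} (hJ : J ∈ siegelSpace g) (hJ₁ : J₁ ∈ siegelSpace g) :
    (J + J₁) * frame J₁ J = 1 := Ring.mul_inverse_cancel _ (isUnit_add hJ hJ₁)

theorem frame_intertwine {J J₁ : EndV g} (hJ : J ∈ siegelSpace g) (hJ₁ : J₁ ∈ siegelSpace g) :
    frame J₁ J * J = J₁ * frame J₁ J ∧ frame J₁ J * J₁ = J * frame J₁ J :=
  intertwine_of_sq_neg_one (siegel_mul_self hJ) (siegel_mul_self hJ₁) (frame_mul hJ hJ₁)
    (mul_frame hJ hJ₁)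

theorem frame_apply_left {J J₁ : EndV g} (hJ : J ∈ siegelSpace g) (hJ₁ : J₁ ∈ siegelSpace g)
    (x : V g) : frame J₁ J (J x) = J₁ (frame J₁ J x) :=
  congrArg (fun T : EndV g => T x) (frame_intertwine hJ hJ₁).1

theorem frame_apply_right {J J₁ : EndV g} (hJ : J ∈ siegelSpace g) (hJ₁ : J₁ ∈ siegelSpace g)
    (x : V g) : frame J₁ J (J₁ x) = J (frame J₁ J x) :=
  congrArg (fun T : EndV g => T x) (frame_intertwine hJ hJ₁).2

theorem eq_zero_of_frame_mul_mul_frame {J J₁ : EndV g} (hJ : J ∈ siegelSpace g) (hJ₁ : J₁ ∈ siegelSpace g)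
    {X : EndV g} (h : ∀ x, frame J₁ J (X (frame J₁ J x)) = 0) :
    X = 0 := by
  ext1 x
  have h1 : ∀ x, (J + J₁) (frame J₁ J x) = x := fun x =>
    congrArg (fun T : EndV g => T x) (mul_frame hJ hJ₁)
  have h2 : ∀ x, frame J₁ J ((J + J₁) x) = x := fun x =>
    congrArg (fun T : EndV g => T x) (frame_mul hJ hJ₁)
  have h3 := h ((J + J₁) x)
  rw [h2] at h3
  rw [← h1 (X x), h3, map_zero, zero_apply]

theorem eq_zero_of_hodge10_comp {J : EndV g} (hJ : J ∈ siegelSpace g) {X : EndV g}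
    (h : ∀ α ∈ hodge10 J, ∀ x, α (X x) = 0) (x : V g) : X x = 0 := by
  ext j
  -- Twice the `(1,0)`-part of the `j`-th coordinate; its real part is that coordinate.
  let α : DualC g := (Complex.ofRealCLM.comp (ContinuousLinearMap.proj j : V g →L[ℝ] ℝ)) +
    (-Complex.I) • (Complex.ofRealCLM.comp (ContinuousLinearMap.proj j : V g →L[ℝ] ℝ)).comp J
  have hα : ∀ x, α x = (x j : ℂ) - Complex.I * (J x j : ℂ) := fun x => by
    simp [α, sub_eq_add_neg]
  have hm : α ∈ hodge10 J := by
    rw [mem_hodge10_iff]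
    intro x
    rw [hα, hα, hJ.1, Pi.neg_apply]
    push_cast
    linear_combination (J x j : ℂ) * Complex.I_mul_I
  have h1 := congrArg Complex.re (h α hm x)
  rw [hα] at h1
  simpa using h1

section Param
variable {B : Set (EndV g)} {D : Set ℂ} {φ : ℂ → EndV g}

theorem IsLocalParam.hasFDerivAt_frame (h : IsLocalParam B D φ) (hB : B ⊆ siegelSpace g)
    {J₁ : EndV g} (hJ₁ : J₁ ∈ siegelSpace g) {z : ℂ} (hz : z ∈ D) :
    ∃ M' : ℂ →L[ℝ] EndV g, HasFDerivAt (fun y => frame J₁ (φ y)) M' z ∧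
      ∀ w x, M' w x = -frame J₁ (φ z) (fderiv ℝ φ z w (frame J₁ (φ z) x)) := by
  obtain ⟨u, hu⟩ := isUnit_add (hB (h.mem hz)) hJ₁
  have h1 := hasFDerivAt_ringInverse (𝕜 := ℝ) u
  rw [hu] at h1
  have h2 := h1.comp z ((h.hasFDerivAt hz).add_const J₁)
  refine ⟨_, h2, fun w x => ?_⟩
  have : frame J₁ (φ z) = (↑u⁻¹ : EndV g) := by rw [frame, ← hu, Ring.inverse_unit]
  rw [this]
  rfl

/-- The frame is compatible with the complex structures. -/
theorem IsLocalParam.frame_fderiv_I (h : IsLocalParam B D φ) (hB : B ⊆ siegelSpace g)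
    {J₁ : EndV g} (hJ₁ : J₁ ∈ siegelSpace g) {z : ℂ} (hz : z ∈ D) (x : V g) :
    frame J₁ (φ z) (fderiv ℝ φ z Complex.I (frame J₁ (φ z) x)) =
      J₁ (frame J₁ (φ z) (fderiv ℝ φ z 1 (frame J₁ (φ z) x))) ∧
    frame J₁ (φ z) (fderiv ℝ φ z Complex.I (frame J₁ (φ z) x)) =
      -frame J₁ (φ z) (fderiv ℝ φ z 1 (frame J₁ (φ z) (J₁ x))) := by
  have hz' := hB (h.mem hz)
  have h1 : ∀ x, fderiv ℝ φ z Complex.I x = φ z (fderiv ℝ φ z 1 x) := fun x => by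
    have := h.holomorphic z hz 1
    rw [mul_one] at this
    rw [this]; rfl
  have h2 : ∀ x, fderiv ℝ φ z 1 (φ z x) = -φ z (fderiv ℝ φ z 1 x) := fun x =>
    congrArg (fun T : EndV g => T x)
      (mem_tangentSpace_iff.1 (h.fderiv_mem_tangentSpace hB hz 1)).1
  constructor
  · rw [h1, frame_apply_left hz' hJ₁]
  · rw [h1, frame_apply_right hz' hJ₁, h2, map_neg, neg_neg]

theorem DifferentiableAt.of_hasFDerivAt_real {E : Type*} [NormedAddCommGroup E] [NormedSpace ℂ E]
    {F : ℂ → E} {F' : ℂ →L[ℝ] E} {z : ℂ} (hF : HasFDerivAt F F' z)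
    (h : F' Complex.I = Complex.I • F' 1) :
    DifferentiableAt ℂ F z ∧ deriv F z = F' 1 := by
  have h1 : HasFDerivAt F (F'.complexOfReal h) z := hasFDerivAt_of_restrictScalars ℝ hF rfl
  refine ⟨h1.differentiableAt, ?_⟩
  rw [h1.hasDerivAt.deriv]; rfl

/-- With `M = (J + J₁)⁻¹`, `dM = -M X M`. Since `M J = J₁ M` and `α J₁ = i α`, replacing `X` by `J
X` multiplies the derivative by `i`, which is the Cauchy-Riemann equation. Thus `X ↦ α(M X M x)` are
complex coordinates on tangent vectors. -/
theorem IsLocalParam.deriv_frame (h : IsLocalParam B D φ) (hB : B ⊆ siegelSpace g)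
    {J₁ : EndV g} (hJ₁ : J₁ ∈ siegelSpace g) {α : DualC g} (hα : α ∈ hodge10 J₁) (x : V g)
    {z : ℂ} (hz : z ∈ D) : DifferentiableAt ℂ (fun y => α (frame J₁ (φ y) x)) z ∧
      deriv (fun y => α (frame J₁ (φ y) x)) z =
        -α (frame J₁ (φ z) (fderiv ℝ φ z 1 (frame J₁ (φ z) x))) := by
  obtain ⟨M', hM, hM'⟩ := h.hasFDerivAt_frame hB hJ₁ hz
  have h1 : HasFDerivAt (fun y => α (frame J₁ (φ y) x))
      (α.comp ((ContinuousLinearMap.apply ℝ (V g) x).comp M')) z :=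
    α.hasFDerivAt.comp z ((ContinuousLinearMap.apply ℝ (V g) x).hasFDerivAt.comp z hM)
  have h2 : ∀ w, (α.comp ((ContinuousLinearMap.apply ℝ (V g) x).comp M')) w = α (M' w x) :=
    fun _ => rfl
  have h3 := DifferentiableAt.of_hasFDerivAt_real h1 (by
    rw [h2, h2, hM', hM', (h.frame_fderiv_I hB hJ₁ hz x).1, map_neg, map_neg,
      mem_hodge10_iff.1 hα, smul_eq_mul]
    ring)
  refine ⟨h3.1, ?_⟩
  rw [h3.2, h2, hM', map_neg]

/-- The vector field `[C, J]` is holomorphic on Siegel space. -/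
theorem IsLocalParam.differentiableAt_commutator (h : IsLocalParam B D φ) (hB : B ⊆ siegelSpace g)
    {J₁ : EndV g} (hJ₁ : J₁ ∈ siegelSpace g) {α : DualC g} (hα : α ∈ hodge10 J₁) (C : EndV g)
    (x : V g) {z : ℂ} (hz : z ∈ D) : DifferentiableAt ℂ
      (fun y => α (frame J₁ (φ y) ((C * φ y - φ y * C) (frame J₁ (φ y) x)))) z := by
  have hα' := mem_hodge10_iff.1 hα
  have hJJ := hJ₁.1
  obtain ⟨M', hM, hM'⟩ := h.hasFDerivAt_frame hB hJ₁ hz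
  let a : EndV g →L[ℝ] DualC g := ContinuousLinearMap.compL ℝ (V g) (V g) ℂ α
  let c : EndV g →L[ℝ] EndV g := ContinuousLinearMap.compL ℝ (V g) (V g) (V g) C
  have hR := (a.hasFDerivAt.comp z hM).clm_comp (c.hasFDerivAt.comp z hM)
  -- By the intertwining relations, `α M [C, J] M x = α M C M J₁ x - i α M C M x`, so only
  -- derivatives of `M` enter.
  have hQ := (hR.clm_apply (hasFDerivAt_const (J₁ x) z)).sub
    ((hR.clm_apply (hasFDerivAt_const x z)).const_smul Complex.I)
  refine (DifferentiableAt.of_hasFDerivAt_real hQ ?_).1.congr_of_eventuallyEq ?_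
  · have k1 := fun x => (h.frame_fderiv_I hB hJ₁ hz x).1
    have k2 := fun x => (h.frame_fderiv_I hB hJ₁ hz x).2
    have m1 : ∀ x, α (M' Complex.I x) = Complex.I * α (M' 1 x) := fun x => by
      rw [hM', hM', k1, map_neg, map_neg, hα']; ring
    have m2 : ∀ x, M' Complex.I x = -M' 1 (J₁ x) := fun x => by
      rw [hM', hM', k2]
    simp [a, c, m1]
    simp [m2, hJJ]
    linear_combination α (frame J₁ (φ z) (C (M' 1 x))) * Complex.I_mul_I
  · filter_upwards [h.isOpen.mem_nhds hz] with y hy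
    have hy' := hB (h.mem hy)
    rw [sub_apply, mul_apply_eq_comp, mul_apply_eq_comp, map_sub, map_sub,
      frame_apply_left hy' hJ₁, hα', ← frame_apply_right hy' hJ₁]
    rfl

/-! ### The vector field of a geodesic along the curve -/

/-- `A ^ 2` commutes with `x`, and the vector field `[A, ·]` is tangent to the curve at `x`. -/
def IsTangentFlow (B : Set (EndV g)) (A x : EndV g) : Prop :=
  A * A * x - x * (A * A) = 0 ∧ ∃ D φ z w, IsLocalParam B D φ ∧ z ∈ D ∧ φ z = x ∧
    fderiv ℝ φ z w = A * x - x * A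

theorem IsTangentFlow.exists_fderiv_eq {A : EndV g} (h : IsLocalParam B D φ) {z : ℂ} (hz : z ∈ D)
    (hA : IsTangentFlow B A (φ z)) : ∃ w, fderiv ℝ φ z w = A * φ z - φ z * A := by
  obtain ⟨-, D', ψ, z', w, h', hz', he, hw⟩ := hA
  obtain ⟨w', h1⟩ := h.exists_fderiv_eq h' hz hz' he.symm w
  exact ⟨w', h1.trans hw⟩

/-- The identity theorem for the condition that `[A, ·]` is tangent to the curve. -/
theorem IsLocalParam.isTangentFlow_of_frequently (h : IsLocalParam B D φ)
    (hB : B ⊆ siegelSpace g) (hD : IsPreconnected D) {A : EndV g} {z₀ : ℂ} (hz₀ : z₀ ∈ D)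
    (hfreq : ∃ᶠ z in 𝓝[≠] z₀, IsTangentFlow B A (φ z)) {z : ℂ} (hz : z ∈ D) :
    IsTangentFlow B A (φ z) := by
  have hJ₁ := hB (h.mem hz₀)
  set J₁ := φ z₀ with hJ₁def
  have hfreq' : ∃ᶠ z in 𝓝[≠] z₀, IsTangentFlow B A (φ z) ∧ z ∈ D :=
    hfreq.and_eventually (mem_nhdsWithin_of_mem_nhds (h.isOpen.mem_nhds hz₀))
  have ident : ∀ f : ℂ → ℂ, DifferentiableOn ℂ f D →
      (∀ z ∈ D, IsTangentFlow B A (φ z) → f z = 0) → ∀ z ∈ D, f z = 0 := fun f hf h0 =>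
    (hf.analyticOnNhd h.isOpen).eqOn_zero_of_preconnected_of_frequently_eq_zero hD hz₀
      (hfreq'.mono fun z hz => h0 z hz.2 hz.1)
  let P : DualC g → V g → ℂ → ℂ := fun α x y => α (frame J₁ (φ y) x)
  let Q : EndV g → DualC g → V g → ℂ → ℂ := fun C α x y =>
    α (frame J₁ (φ y) ((C * φ y - φ y * C) (frame J₁ (φ y) x)))
  have hP : ∀ α ∈ hodge10 J₁, ∀ x, DifferentiableOn ℂ (P α x) D := fun α hα x z hz =>
    (h.deriv_frame hB hJ₁ hα x hz).1.differentiableWithinAt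
  have hP' : ∀ α ∈ hodge10 J₁, ∀ x, ∀ z ∈ D, deriv (P α x) z =
      -α (frame J₁ (φ z) (fderiv ℝ φ z 1 (frame J₁ (φ z) x))) := fun α hα x z hz =>
    (h.deriv_frame hB hJ₁ hα x hz).2
  have hdP : ∀ α ∈ hodge10 J₁, ∀ x, DifferentiableOn ℂ (deriv (P α x)) D := fun α hα x =>
    (hP α hα x).deriv h.isOpen
  have hQ : ∀ C, ∀ α ∈ hodge10 J₁, ∀ x, DifferentiableOn ℂ (Q C α x) D := fun C α hα x z hz =>
    (h.differentiableAt_commutator hB hJ₁ hα C x hz).differentiableWithinAt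
  have hz' := hB (h.mem hz)
  refine ⟨eq_zero_of_frame_mul_mul_frame hz' hJ₁ fun x => ?_, ?_⟩
  · refine eq_zero_of_hodge10_comp hJ₁
      (X := frame J₁ (φ z) * (A * A * φ z - φ z * (A * A)) * frame J₁ (φ z)) (fun α hα x => ?_) x
    refine ident (Q (A * A) α x) (hQ _ α hα x) (fun y _ hy => ?_) z hz
    simp only [Q]
    rw [hy.1, zero_apply, map_zero, map_zero]
  · have hlin : ∀ α ∈ hodge10 J₁, ∀ x, ∀ z ∈ D, ∀ c : ℂ,
        α (frame J₁ (φ z) (fderiv ℝ φ z c (frame J₁ (φ z) x))) = -c * deriv (P α x) z := by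
      intro α hα x z hz c
      have hc := h.fderiv_mul hz c 1
      rw [mul_one] at hc
      rw [hP' α hα x z hz, hc, add_apply, smul_apply, smul_apply, map_add, map_smul, map_smul,
        mul_apply_eq_comp, frame_apply_left (hB (h.mem hz)) hJ₁, map_add, map_smul, map_smul,
        mem_hodge10_iff.1 hα, Complex.real_smul, Complex.real_smul]
      conv_rhs => rw [← Complex.re_add_im c]
      ring
    -- The coordinates of `dφ(1)` and `[A, J]` are proportional where `[A, J]` is tangent to the
    -- curve. The 2×2 minors are holomorphic, so they vanish on all of `D`.
    have hminor : ∀ α ∈ hodge10 J₁, ∀ β ∈ hodge10 J₁, ∀ x y, ∀ z ∈ D,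
        deriv (P α x) z * Q A β y z - deriv (P β y) z * Q A α x z = 0 := by
      intro α hα β hβ x y
      refine ident _ (((hdP α hα x).mul (hQ A β hβ y)).sub ((hdP β hβ y).mul (hQ A α hα x)))
        fun z hz hz1 => ?_
      obtain ⟨c, hc⟩ := hz1.exists_fderiv_eq h hz
      have h1 := hlin α hα x z hz c
      have h2 := hlin β hβ y z hz c
      rw [hc] at h1 h2
      change deriv (P α x) z * Q A β y z - deriv (P β y) z * Q A α x z = 0
      change Q A α x z = _ at h1
      change Q A β y z = _ at h2
      rw [h1, h2]
      ring
    -- As `φ` is an immersion, some coordinate of `dφ(1)` is nonzero at `z`; dividing by it gives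
    -- the proportionality factor.
    obtain ⟨β, hβ, y, hne⟩ : ∃ β ∈ hodge10 J₁, ∃ y, deriv (P β y) z ≠ 0 := by
      by_contra! hall
      have h0 : fderiv ℝ φ z 1 = 0 := eq_zero_of_frame_mul_mul_frame hz' hJ₁ fun x =>
        eq_zero_of_hodge10_comp hJ₁
          (X := frame J₁ (φ z) * fderiv ℝ φ z 1 * frame J₁ (φ z)) (fun α hα x => by
            have := hall α hα x
            rw [hP' α hα x z hz] at this
            exact neg_eq_zero.1 this) x
      have := h.immersion z hz (h0.trans (map_zero (fderiv ℝ φ z)).symm)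
      exact one_ne_zero this
    set c : ℂ := -(Q A β y z / deriv (P β y) z) with hc
    refine ⟨D, φ, z, c, h, hz, rfl, ?_⟩
    rw [← sub_eq_zero]
    refine eq_zero_of_frame_mul_mul_frame hz' hJ₁ fun x => eq_zero_of_hodge10_comp hJ₁
      (X := frame J₁ (φ z) * (fderiv ℝ φ z c - (A * φ z - φ z * A)) * frame J₁ (φ z))
      (fun α hα x => ?_) x
    have h1 := hminor α hα β hβ x y z hz
    have h2 := hlin α hα x z hz c
    change α (frame J₁ (φ z) ((fderiv ℝ φ z c - (A * φ z - φ z * A)) (frame J₁ (φ z) x))) = 0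
    rw [sub_apply, map_sub, map_sub, h2]
    change -c * deriv (P α x) z - Q A α x z = 0
    rw [hc]
    field_simp
    linear_combination h1

end Param

section Param
variable {B : Set (EndV g)} {D : Set ℂ} {φ : ℂ → EndV g}

/-- The generator of a geodesic contained in a connected curve defines a vector field that is
tangent to the curve everywhere. -/
theorem IsComplexCurve.exists_isTangentFlow (hB : IsComplexCurve B) (hconn : IsConnected B)
    (hgeo : ∃ S, IsGeodesicSegment S ∧ S ⊆ B) :
    ∃ J₀ ∈ siegelSpace g, ∃ A ∈ tangentSpace J₀, A ≠ 0 ∧ ∀ x ∈ B, IsTangentFlow B A x := by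
  obtain ⟨S, ⟨γ, a, b, hγ, ⟨t₁, t₂, hne⟩, hab, rfl⟩, hS⟩ := hgeo
  obtain ⟨A, hA, hγ'⟩ := hγ.exists_generator
  have hA0 : A ≠ 0 := by
    rintro rfl
    refine hne (is_const_of_deriv_eq_zero (fun t => (hγ' t).1.differentiableAt) (fun t => ?_) t₁ t₂)
    rw [(hγ' t).1.deriv, zero_mul, mul_zero, sub_zero]
  refine ⟨γ 0, hγ.mem 0, A, hA, hA0, ?_⟩
  have hγB : ∀ t ∈ Set.Ioo a b, ∀ᶠ t' in 𝓝 t, γ t' ∈ B := fun t ht => by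
    filter_upwards [Ioo_mem_nhds ht.1 ht.2] with t' ht'
    exact hS ⟨t', Set.Ioo_subset_Icc_self ht', rfl⟩
  have hgood : ∀ t ∈ Set.Ioo a b, IsTangentFlow B A (γ t) := by
    intro t ht
    have hanti : ∀ x, A (γ t x) = -γ t (A x) := fun x =>
      congrArg (fun T : EndV g => T x) (hγ' t).2
    refine ⟨ContinuousLinearMap.ext fun x => ?_, ?_⟩
    · simp only [sub_apply, mul_apply_eq_comp, hanti, map_neg, neg_neg, sub_self, zero_apply]
    · obtain ⟨D, φ, h, z, hz, he⟩ := hB.exists_param _ (hγB t ht).self_of_nhds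
      obtain ⟨-, ζ', -, -, -, h1⟩ := h.exists_lift (hγ' t).1.hasFDerivAt (hγB t ht) hz he
      refine ⟨D, φ, z, ζ' 1, h, hz, he, ?_⟩
      have := congrArg (fun T : ℝ →L[ℝ] EndV g => T 1) h1
      simpa using this.symm
  obtain ⟨t₀, ht₀⟩ : ∃ t₀, t₀ ∈ Set.Ioo a b := Set.nonempty_Ioo.2 hab
  have hx₀ : γ t₀ ∈ B := (hγB t₀ ht₀).self_of_nhds
  have hballs : ∀ x ∈ B, ∃ φ z r, 0 < r ∧ IsLocalParam B (Metric.ball z r) φ ∧ φ z = x := by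
    intro x hx
    obtain ⟨φ, z, r, hr, h, he, -⟩ := hB.exists_ball (A := B) ⟨Set.univ, isOpen_univ, by simp⟩ hx
    exact ⟨φ, z, r, hr, h, he⟩
  -- The interior of the good set: it is open by definition, closed by the identity theorem on
  -- discs, and nonempty because the geodesic supplies accumulating good points.
  let G : Set B := {x | ∀ᶠ y : B in 𝓝 x, IsTangentFlow B A y}
  have hnhds : ∀ {z : ℂ} {r : ℝ} {φ : ℂ → EndV g} (x : B), 0 < r →
      IsLocalParam B (Metric.ball z r) φ → φ z = x →
      ∀ᶠ y : B in 𝓝 x, ∃ z' ∈ Metric.ball z r, φ z' = y := by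
    intro z r φ x hr h he
    obtain ⟨W, hW, hWe⟩ := h.open_image
    have hxW : (x : EndV g) ∈ W := by
      rw [← he]
      exact (hWe.subset ⟨z, Metric.mem_ball_self hr, rfl⟩).2
    filter_upwards [continuous_subtype_val.continuousAt.preimage_mem_nhds (hW.mem_nhds hxW)]
      with y hy
    have : (y : EndV g) ∈ φ '' Metric.ball z r := hWe ▸ ⟨y.2, hy⟩
    exact this
  have hfill : ∀ {z : ℂ} {r : ℝ} {φ : ℂ → EndV g} {z₀ : ℂ} (x : B), 0 < r →
      IsLocalParam B (Metric.ball z r) φ → φ z = x → z₀ ∈ Metric.ball z r →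
      (∃ᶠ y in 𝓝[≠] z₀, IsTangentFlow B A (φ y)) → x ∈ G := by
    intro z r φ z₀ x hr h he hz₀ hf
    filter_upwards [hnhds x hr h he] with y hy
    obtain ⟨z', hz', hy⟩ := hy
    rw [← hy]
    exact h.isTangentFlow_of_frequently hB.subset (convex_ball z r).isPreconnected hz₀ hf hz'
  have hGopen : IsOpen G := isOpen_iff_mem_nhds.2 fun x hx => eventually_eventually_nhds.2 hx
  have hGclosed : IsClosed G := by
    rw [← closure_subset_iff_isClosed]
    intro x hx
    obtain ⟨φ, z, r, hr, h, he⟩ := hballs x x.2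
    obtain ⟨y, hyG, z', hz', hy⟩ :=
      ((mem_closure_iff_frequently.1 hx).and_eventually (hnhds x hr h he)).exists
    refine hfill x hr h he hz' (Eventually.frequently ?_)
    have hc : Tendsto (fun t : Metric.ball z r => (⟨φ t, h.mem t.2⟩ : B)) (𝓝 ⟨z', hz'⟩) (𝓝 y) := by
      rw [tendsto_subtype_rng, ← hy]
      exact h.embedding.continuous.continuousAt
    have h1 := hc.eventually hyG
    rw [nhds_subtype_eq_comap, eventually_comap] at h1
    refine eventually_nhdsWithin_of_eventually_nhds ?_
    filter_upwards [h1, h.isOpen.mem_nhds hz'] with t ht htD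
    exact ht ⟨t, htD⟩ rfl
  have hGne : G.Nonempty := by
    refine ⟨⟨γ t₀, hx₀⟩, ?_⟩
    obtain ⟨φ, z, r, hr, h, he⟩ := hballs _ hx₀
    obtain ⟨ζ, ζ', hζ, hζd, hev, -⟩ := h.exists_lift (hγ' t₀).1.hasFDerivAt (hγB t₀ ht₀)
      (Metric.mem_ball_self hr) he
    refine hfill _ hr h he (Metric.mem_ball_self hr) ?_
    -- The velocity is nonzero, so `γ` leaves `γ t₀` at once and its lift yields good parameters
    -- different from `z` that accumulate at `z`.
    have hder : A * γ t₀ - γ t₀ * A ≠ 0 := by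
      intro h0
      refine hA0 (ContinuousLinearMap.ext fun x => ?_)
      have h1 : ∀ x, A (γ t₀ x) = -γ t₀ (A x) := fun x =>
        congrArg (fun T : EndV g => T x) (hγ' t₀).2
      have h2 := congrArg (fun T : EndV g => T (γ t₀ x)) h0
      have h3 := (hγ.mem t₀).1
      simp only [sub_apply, mul_apply_eq_comp, h1, h3, map_neg, neg_neg, zero_apply] at h2
      have h4 : (2 : ℝ) • A x = 0 := by
        rw [two_smul, ← neg_eq_zero, ← h2]; abel
      exact (smul_eq_zero.1 h4).resolve_left two_ne_zero
    have hne : ∀ᶠ t in 𝓝[≠] t₀, γ t ≠ γ t₀ := (hγ' t₀).1.eventually_ne hder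
    have htend : Tendsto ζ (𝓝[≠] t₀) (𝓝[≠] z) := by
      refine tendsto_nhdsWithin_iff.2 ⟨?_, ?_⟩
      · have := hζd.continuousAt.tendsto
        rw [hζ] at this
        exact this.mono_left nhdsWithin_le_nhds
      · filter_upwards [hne, eventually_nhdsWithin_of_eventually_nhds hev] with t h1 h2 h3
        rw [Set.mem_singleton_iff] at h3
        rw [h3, he] at h2
        exact h1 h2.2.symm
    refine htend.frequently (Eventually.frequently ?_)
    filter_upwards [eventually_nhdsWithin_of_eventually_nhds hev,
      eventually_nhdsWithin_of_eventually_nhds (Ioo_mem_nhds ht₀.1 ht₀.2)] with t h1 h2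
    rw [h1.2]
    exact hgood t h2
  have : PreconnectedSpace B := Subtype.preconnectedSpace hconn.isPreconnected
  have hG := IsClopen.eq_univ ⟨hGclosed, hGopen⟩ hGne
  intro x hx
  have hxG : ∀ᶠ y : B in 𝓝 ⟨x, hx⟩, IsTangentFlow B A y := hG.symm.subset (Set.mem_univ _)
  exact hxG.self_of_nhds

/-! ### The kernel bundle along a tangent flow -/

section Flow
variable {J₀ A : EndV g}

theorem comp_fderiv_eq_zero_of_comp (hB : B ⊆ siegelSpace g) (hJ₀ : J₀ ∈ siegelSpace g)
    (hA : A ∈ tangentSpace J₀) (hA0 : A ≠ 0) (h : IsLocalParam B D φ) {z : ℂ} (hz : z ∈ D)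
    (hflow : IsTangentFlow B A (φ z)) {u : DualC g} (hu : u.comp A = 0) (w : ℂ) (x : V g) :
    u (fderiv ℝ φ z w x) = 0 := by
  have hJ := hB (h.mem hz)
  obtain ⟨c, hc⟩ := hflow.exists_fderiv_eq h hz
  have hcomm := sub_eq_zero.1 hflow.1
  -- If `c = 0`, then `A` commutes with `J = φ z`, and the kernel comparison gives `A = 0`. So `[A,
  -- J]` spans the tangent line over `ℂ`.
  have hc0 : c ≠ 0 := by
    rintro rfl
    rw [map_zero] at hc
    refine hA0 (ContinuousLinearMap.ext fun x => ?_)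
    refine apply_eq_zero_of_commutator hJ₀ hA hJ hcomm ?_
    exact congrArg (fun T : EndV g => T x) (sub_eq_zero.1 hc.symm)
  have h1 := comp_commutator_eq_zero_of_comp hJ₀ hA hcomm hu
  rw [← hc] at h1
  have h2 : ∀ x, u (fderiv ℝ φ z c x) = 0 := fun x => congrArg (fun T : DualC g => T x) h1
  have h3 : φ z (fderiv ℝ φ z c x) = -fderiv ℝ φ z c (φ z x) := by
    have := congrArg (fun T : EndV g => T x)
      (mem_tangentSpace_iff.1 (h.fderiv_mem_tangentSpace hB hz c)).1
    exact (neg_eq_iff_eq_neg.2 this).symm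
  have h4 := h.fderiv_mul hz (w / c) c
  rw [div_mul_cancel₀ w hc0] at h4
  rw [h4, add_apply, smul_apply, smul_apply, mul_apply_eq_comp, h3, map_add, map_smul, map_smul,
    map_neg, h2, h2]
  simp

/-- The function `u ∘ φ y` of `y` has derivative `u ∘ dφ = 0`, so the relation `u ∘ J = i u`
persists along the disc. -/
theorem mem_hodge10_of_ball (hB : B ⊆ siegelSpace g) (hJ₀ : J₀ ∈ siegelSpace g)
    (hA : A ∈ tangentSpace J₀) (hA0 : A ≠ 0) {z : ℂ} {r : ℝ}
    (h : IsLocalParam B (Metric.ball z r) φ) (hflow : ∀ x ∈ B, IsTangentFlow B A x) {u : DualC g}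
    (hu : u.comp A = 0) {z₁ z₂ : ℂ} (hz₁ : z₁ ∈ Metric.ball z r) (hz₂ : z₂ ∈ Metric.ball z r)
    (hm : u ∈ hodge10 (φ z₁)) : u ∈ hodge10 (φ z₂) := by
  rw [mem_hodge10_iff] at hm ⊢
  intro x
  rw [← hm x]
  have hd : ∀ y ∈ Metric.ball z r, HasFDerivAt (fun y => u (φ y x)) (0 : ℂ →L[ℝ] ℂ) y := by
    intro y hy
    have h1 : HasFDerivAt (fun y => u (φ y x))
        (u.comp ((ContinuousLinearMap.apply ℝ (V g) x).comp (fderiv ℝ φ y))) y :=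
      u.hasFDerivAt.comp y
        ((ContinuousLinearMap.apply ℝ (V g) x).hasFDerivAt.comp y (h.hasFDerivAt hy))
    have h2 : u.comp ((ContinuousLinearMap.apply ℝ (V g) x).comp (fderiv ℝ φ y)) = 0 :=
      ContinuousLinearMap.ext fun w =>
        comp_fderiv_eq_zero_of_comp hB hJ₀ hA hA0 h hy (hflow _ (h.mem hy)) hu w x
    rwa [h2] at h1
  exact Metric.isOpen_ball.is_const_of_fderiv_eq_zero (convex_ball z r).isPreconnected
    (fun y hy => (hd y hy).differentiableAt.differentiableWithinAt) (fun y hy => (hd y hy).fderiv)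
    hz₂ hz₁

theorem isHodgeFlatSection_const {A' : Set (EndV g)} {u : DualC g}
    (hu : ∀ y ∈ A', u ∈ hodge10 y) : IsHodgeFlatSection B A' (fun _ => u) where
  smooth _ _ _ _ := contDiffOn_const
  mem := hu
  flat := by
    rintro x - v ξ ⟨D, φ, z, w, -, -, -, -, rfl⟩ β -
    have : fderiv ℝ ((fun _ => u) ∘ φ) z = 0 := fderiv_const_apply u
    simp [this, hodgeForm, polarization]

/-- When `∇s` in the direction `[A, J]` lies in `ℋ^{1,0}`, the differentiated Hodge relation leaves
`s ∘ [A, J] = 0`, and this is equivalent to `s ∘ A = 0`. -/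
theorem IsHodgeSection.comp_eq_zero_of_vanishes (hB : IsComplexCurve B) (hJ₀ : J₀ ∈ siegelSpace g)
    (hA : A ∈ tangentSpace J₀) {A' : Set (EndV g)} (hA' : IsOpenIn B A') {s : EndV g → DualC g}
    (hs : IsHodgeSection B A' s) {x : EndV g} (hx : x ∈ A') (hv : SecondFormVanishesAt B s x)
    (hflow : IsTangentFlow B A x) : (s x).comp A = 0 := by
  obtain ⟨φ, z, r, hr, h, rfl, hmaps⟩ := hB.exists_ball hA' hx
  have hz := Metric.mem_ball_self (x := z) hr
  have hd : HasFDerivAt (s ∘ φ) (fderiv ℝ (s ∘ φ) z) z :=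
    ((((hs.holomorphic _ φ h hmaps).differentiableAt (h.isOpen.mem_nhds hz)).restrictScalars
      ℝ).hasFDerivAt)
  obtain ⟨c, hc⟩ := hflow.exists_fderiv_eq h hz
  refine comp_eq_zero_of_comp_commutator hJ₀ hA (hB.subset (h.mem hz)) (sub_eq_zero.1 hflow.1) ?_
  rw [← hc]
  ext1 y
  have h1 := h.deriv_hodge_relation hz hd (fun y hy => hs.mem _ (hmaps hy)) c y
  have h2 := hv _ _ ⟨_, φ, z, c, h, hz, rfl, rfl, rfl⟩
  rw [Submodule.mkQ_apply, Submodule.Quotient.mk_eq_zero, mem_hodge10_iff] at h2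
  rw [h2 y] at h1
  exact add_eq_left.1 h1

end Flow

/-! ### Unitary flat sections -/

theorem IsHodgeFlatSection.isUnitaryFlatSection {A : Set (EndV g)} {s : EndV g → DualC g}
    (hA : IsOpenIn B A) (hs : IsHodgeFlatSection B A s) : IsUnitaryFlatSection B A s :=
  fun _ hx => ⟨A, hA, hx, subset_rfl, 1, fun _ _ => 1, fun _ => s,
    fun _ _ _ _ _ => differentiableOn_const _, fun _ => hs, fun y _ => by simp⟩

/-- Flat sections have zero derivative, so differentiating `∑ fᵢ uᵢ` only differentiates the
coefficients and the result stays in `ℋ^{1,0}`. -/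
theorem IsUnitaryFlatSection.hasFDerivAt {A : Set (EndV g)} {s : EndV g → DualC g}
    (hs : IsUnitaryFlatSection B A s) (hB : B ⊆ siegelSpace g) (h : IsLocalParam B D φ) {z : ℂ}
    (hz : z ∈ D) (hA : φ z ∈ A) : s (φ z) ∈ hodge10 (φ z) ∧ ∃ F' : ℂ →L[ℂ] DualC g,
      HasFDerivAt (s ∘ φ) F' z ∧ ∀ w, F' w ∈ hodge10 (φ z) := by
  obtain ⟨A', hA', hzA', -, n, f, u, hf, hu, hsum⟩ := hs _ hA
  obtain ⟨r, hr, h', -, hmaps⟩ := h.exists_restrict hA' hz hzA'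
  have hz' := Metric.mem_ball_self (x := z) hr
  refine ⟨?_, ?_⟩
  · rw [hsum _ hzA']
    exact Submodule.sum_mem _ fun i _ => Submodule.smul_mem _ _ ((hu i).mem _ hzA')
  have hfd : ∀ i, HasFDerivAt (f i ∘ φ) (fderiv ℂ (f i ∘ φ) z) z := fun i =>
    ((hf i _ φ h' hmaps).differentiableAt (h'.isOpen.mem_nhds hz')).hasFDerivAt
  have hsd := HasFDerivAt.fun_sum (u := Finset.univ) fun i _ =>
    (hfd i).smul ((hu i).hasFDerivAt hB h' hmaps hz')
  refine ⟨_, hsd.congr_of_eventuallyEq ?_, fun w => ?_⟩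
  · filter_upwards [h'.isOpen.mem_nhds hz'] with y hy
    exact hsum _ (hmaps hy)
  · rw [sum_apply]
    refine Submodule.sum_mem _ fun i _ => ?_
    rw [smul_zero, zero_add]
    exact Submodule.smul_mem _ _ ((hu i).mem _ hzA')

theorem IsUnitaryFlatSection.isKernelSection {A : Set (EndV g)} {s : EndV g → DualC g}
    (hs : IsUnitaryFlatSection B A s) (hB : IsComplexCurve B) (hA : A ⊆ B) :
    IsKernelSection B A s where
  section_hodge :=
    { holomorphic := fun D φ h hmaps z hz => by
        obtain ⟨-, F', hF', -⟩ := hs.hasFDerivAt hB.subset h hz (hmaps hz)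
        exact hF'.differentiableAt.differentiableWithinAt
      mem := fun x hx => by
        obtain ⟨D, φ, h, z, hz, rfl⟩ := hB.exists_param x (hA hx)
        exact (hs.hasFDerivAt hB.subset h hz hx).1 }
  vanishes := by
    rintro x hx v ξ ⟨D, φ, z, w, h, hz, rfl, rfl, rfl⟩
    obtain ⟨-, F', hF', hm⟩ := hs.hasFDerivAt hB.subset h hz hx
    rw [Submodule.mkQ_apply, Submodule.Quotient.mk_eq_zero, (hF'.restrictScalars ℝ).fderiv]
    exact hm w

end Param

/-! ### Equality of the kernel bundle and the unitary flat bundle -/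

theorem exists_linear_coordinates {E : Type*} [NormedAddCommGroup E] [NormedSpace ℂ E]
    [FiniteDimensional ℂ E] (W : Submodule ℂ E) :
    ∃ (n : ℕ) (l : Fin n → E →L[ℂ] ℂ) (b : Fin n → E), (∀ i, b i ∈ W) ∧
      ∀ v ∈ W, v = ∑ i, l i v • b i := by
  obtain ⟨π, hπ⟩ := LinearMap.exists_leftInverse_of_injective W.subtype W.ker_subtype
  let b := Module.finBasis ℂ W
  refine ⟨_, fun i => LinearMap.toContinuousLinearMap (b.coord i ∘ₗ π), fun i => (b i : E),
    fun i => (b i).2, fun v hv => ?_⟩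
  have h1 : π v = ⟨v, hv⟩ := congrArg (fun T : W →ₗ[ℂ] W => T ⟨v, hv⟩) hπ
  have h2 := congrArg W.subtype (b.sum_repr ⟨v, hv⟩)
  rw [map_sum] at h2
  refine h2.symm.trans (Finset.sum_congr rfl fun i _ => ?_)
  rw [map_smul]
  change _ = (b.coord i (π v)) • (b i : E)
  rw [h1]; rfl

theorem IsKernelSection.isUnitaryFlatSection {B : Set (EndV g)} {J₀ A : EndV g}
    (hB : IsComplexCurve B) (hJ₀ : J₀ ∈ siegelSpace g) (hA : A ∈ tangentSpace J₀) (hA0 : A ≠ 0)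
    (hflow : ∀ x ∈ B, IsTangentFlow B A x) {A' : Set (EndV g)} (hA' : IsOpenIn B A')
    {s : EndV g → DualC g} (hs : IsKernelSection B A' s) : IsUnitaryFlatSection B A' s := by
  intro x hx
  obtain ⟨φ, z, r, hr, h, rfl, hmaps⟩ := hB.exists_ball hA' hx
  have hz := Metric.mem_ball_self (x := z) hr
  have hsub : φ '' Metric.ball z r ⊆ A' := Set.image_subset_iff.2 hmaps
  -- The same space `W` is the fibre of `𝒦` at every point of the disc. A basis of `W` gives
  -- constant flat sections, and linear coordinates of `s` give holomorphic coefficients.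
  let W : Submodule ℂ (DualC g) :=
    { carrier := {u | u ∈ hodge10 (φ z) ∧ u.comp A = 0}
      zero_mem' := ⟨Submodule.zero_mem _, ContinuousLinearMap.zero_comp A⟩
      add_mem' := fun {a b} ha hb => ⟨Submodule.add_mem _ ha.1 hb.1, by
        rw [ContinuousLinearMap.add_comp, ha.2, hb.2, add_zero]⟩
      smul_mem' := fun c {a} ha => ⟨Submodule.smul_mem _ _ ha.1, by
        rw [ContinuousLinearMap.smul_comp, ha.2]; ext1 y; exact smul_zero c⟩ }
  have : FiniteDimensional ℂ (DualC g) := Module.Finite.of_restrictScalars_finite ℝ ℂ _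
  obtain ⟨n, l, b, hbW, hb⟩ := exists_linear_coordinates W
  refine ⟨φ '' Metric.ball z r, h.isOpenIn, ⟨z, hz, rfl⟩, hsub, n, fun i y => l i (s y),
    fun i _ => b i, fun i D ψ hψ hm => ?_, fun i => isHodgeFlatSection_const ?_, ?_⟩
  · exact (l i).differentiable.comp_differentiableOn
      (hs.section_hodge.holomorphic D ψ hψ fun y hy => hsub (hm hy))
  · rintro _ ⟨z', hz', rfl⟩
    exact mem_hodge10_of_ball hB.subset hJ₀ hA hA0 h hflow (hbW i).2 hz hz' (hbW i).1
  · rintro _ ⟨z', hz', rfl⟩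
    have h1 : (s (φ z')).comp A = 0 :=
      hs.section_hodge.comp_eq_zero_of_vanishes hB hJ₀ hA hA' (hmaps hz')
        (hs.vanishes _ (hmaps hz')) (hflow _ (h.mem hz'))
    exact hb _ ⟨mem_hodge10_of_ball hB.subset hJ₀ hA hA0 h hflow h1 hz' hz
      (hs.section_hodge.mem _ (hmaps hz')), h1⟩

theorem kernelFibre_eq_unitaryFlatFibre {B : Set (EndV g)} {J₀ A : EndV g}
    (hB : IsComplexCurve B) (hJ₀ : J₀ ∈ siegelSpace g) (hA : A ∈ tangentSpace J₀) (hA0 : A ≠ 0)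
    (hflow : ∀ x ∈ B, IsTangentFlow B A x) {x : EndV g} (hx : x ∈ B) :
    kernelFibre B x = unitaryFlatFibre B x := by
  ext u
  constructor
  · rintro ⟨A', s, hA', hxA', hs, rfl, hv⟩
    have h1 := hs.comp_eq_zero_of_vanishes hB hJ₀ hA hA' hxA' hv (hflow x hx)
    obtain ⟨φ, z, r, hr, h, rfl, -⟩ := hB.exists_ball hA' hxA'
    have hz := Metric.mem_ball_self (x := z) hr
    refine ⟨_, fun _ => s (φ z), h.isOpenIn, ⟨z, hz, rfl⟩, isHodgeFlatSection_const ?_, rfl⟩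
    rintro _ ⟨z', hz', rfl⟩
    exact mem_hodge10_of_ball hB.subset hJ₀ hA hA0 h hflow h1 hz hz' (hs.mem _ hxA')
  · rintro ⟨A', s, hA', hxA', hs, rfl⟩
    have hsub : A' ⊆ B := by
      obtain ⟨W, -, rfl⟩ := hA'
      exact Set.inter_subset_left
    have hk := (hs.isUnitaryFlatSection hA').isKernelSection hB hsub
    exact ⟨A', s, hA', hxA', hk.section_hodge, rfl, hk.vanishes x hxA'⟩

end SiegelVHS

end

theorem lemma3p2 (g : ℕ) (B : Set (SiegelVHS.EndV g))
    (hB : SiegelVHS.IsComplexCurve B) (hconn : IsConnected B)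
    (hgeo : ∃ S, SiegelVHS.IsGeodesicSegment S ∧ S ⊆ B) :
    (∀ A, SiegelVHS.IsOpenIn B A → ∀ s,
      SiegelVHS.IsKernelSection B A s ↔ SiegelVHS.IsUnitaryFlatSection B A s) ∧
    ∀ x ∈ B, SiegelVHS.kernelFibre B x = SiegelVHS.unitaryFlatFibre B x := by
  obtain ⟨J₀, hJ₀, A, hA, hA0, hflow⟩ := hB.exists_isTangentFlow hconn hgeo
  refine ⟨fun A' hA' s => ⟨fun hs => ?_, fun hs => ?_⟩, fun x hx => ?_⟩
  · exact hs.isUnitaryFlatSection hB hJ₀ hA hA0 hflow hA'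
  · refine hs.isKernelSection hB ?_
    obtain ⟨W, -, rfl⟩ := hA'
    exact Set.inter_subset_left
  · exact SiegelVHS.kernelFibre_eq_unitaryFlatFibre hB hJ₀ hA hA0 hflow hx
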